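/- Let $p$ be a prime and let $L$ be a non-abelian free $\mathbb{F}_p$-Lie algebra on a finite set $X$ of free generators. For $n\ge 1$ let $L_n$ be the $\mathbb{F}_p$-span of all Lie commutators of weight $n$ in $X$ (iterated brackets with $n$ entries from $X$), so that $L=\bigoplus_{n\ge1}L_n$, and put $L_{>n}=\bigoplus_{m>n}L_m$. The density of a Lie subalgebra $M\le L$ is $$\operatorname{dens}_L(M)=\liminf_{n\to\infty}\frac{\dim_{\mathbb{F}_p}\big((M+L_{>n})/L_{>n}\big)}{\dim_{\mathbb{F}_p}(L/L_{>n})},$$ and the density spectrum of $L$ is $\operatorname{dspec}(L)=\{\operatorname{dens}_L(M)\mid M\le L \text{ a Lie subalgebra}\}$. Basic commutators in $X$ are defined inductively. Those of weight $1$ are the elements of $X$, in some well-order. For $n\ge2$, those of weight $n$ are the Lie commutators $[u,v]$, where $u,v$ are basic commutators whose weights add up to $n$ such that $u>v$ and such that, if $u=[y,z]$ with basic commutators $y,z$, then $v\ge z$. The well-order is extended so that basic commutators of smaller weight come first, and arbitrarily among those of weight $n$. Fix any such system of basic commutators. Then for every $\alpha\in[0,1]$ there is a Lie subalgebra $M\le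 L$ that is freely generated, as a Lie algebra, by some set of basic commutators and satisfies $\operatorname{dens}_L(M)=\alpha$. In particular, $\operatorname{dspec}(L)=[0,1]$. -/

import Mathlib

noncomputable section

namespace FreeLieDensity

/-! ### Lie commutators, weights and the natural grading of a free Lie algebra -/

/-- The value in the free Lie algebra on `X` of a (formal, bracketed) commutator in `X`.
The weight of a formal commutator `w : FreeMagma X` is the number `w.length` of its letters. -/
def commutatorValue (K : Type*) [CommRing K] {X : Type*} : FreeMagma X → FreeLieAlgebra K X
  | .of x => FreeLieAlgebra.of K x
  | .mul u v => ⁅commutatorValue K u, commutatorValue K v⁆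

/-- The homogeneous component of degree `n` of the free Lie algebra on `X`: the span of all Lie
commutators of weight `n`. -/
def homogeneousComponent (K : Type*) [CommRing K] (X : Type*) (n : ℕ) :
    Submodule K (FreeLieAlgebra K X) :=
  Submodule.span K (commutatorValue K '' {w : FreeMagma X | w.length = n})

/-! ### Density with respect to a grading -/

section Density

variable {K L : Type*} [Field K] [LieRing L] [LieAlgebra K L]

/-- `L_{>n}`, the sum of all homogeneous components of degree greater than `n`. -/
def degreeGT (𝒜 : ℕ → Submodule K L) (n : ℕ) : Submodule K L :=
  ⨆ m : ℕ, ⨆ _ : n < m, 𝒜 m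

/-- The (lower) density of a Lie subalgebra `S` of `L`, with respect to a grading `𝒜` of `L` by
finite dimensional components: the lower limit of
`dim ((S + L_{>n}) / L_{>n}) / dim (L / L_{>n})` as `n → ∞`. -/
def density (𝒜 : ℕ → Submodule K L) (S : LieSubalgebra K L) : ℝ :=
  Filter.liminf (fun n : ℕ =>
    (Module.finrank K (S.toSubmodule.map (degreeGT 𝒜 n).mkQ) : ℝ) /
      (Module.finrank K (L ⧸ degreeGT 𝒜 n) : ℝ)) Filter.atTop

/-- The density spectrum: the set of densities of all Lie subalgebras. -/
def densitySpectrum (𝒜 : ℕ → Submodule K L) : Set ℝ :=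
  {a : ℝ | ∃ S : LieSubalgebra K L, density 𝒜 S = a}

/-- The Lie subalgebra `M` is generated by `Y`, and is free on `Y`. -/
def IsFreelyGeneratedBy (M : LieSubalgebra K L) (Y : Set L) : Prop :=
  LieSubalgebra.lieSpan K L Y = M ∧
    Function.Injective (FreeLieAlgebra.lift K (fun y : Y => (y : L)))

end Density

/-! ### Basic commutators -/

/-- Basic commutators with respect to a strict order `r` (read `r u v` as `u < v`): the generators
are basic, and `[u, v]` is basic when `u` and `v` are basic, `u > v`, and `v ≥ z` whenever
`u = [y, z]`. -/
inductive IsBasic {X : Type*} (r : FreeMagma X → FreeMagma X → Prop) : FreeMagma X → Prop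
  | of (x : X) : IsBasic r (FreeMagma.of x)
  | mul (u v : FreeMagma X) (hu : IsBasic r u) (hv : IsBasic r v) (huv : r v u)
      (hz : ∀ y z : FreeMagma X, u = y * z → r z v ∨ z = v) : IsBasic r (u * v)

/-- `r` is an admissible order for forming basic commutators: it well-orders the basic
commutators that it gives rise to, and basic commutators of smaller weight come first
(the order among basic commutators of equal weight is arbitrary). -/
structure IsBasicOrder {X : Type*} (r : FreeMagma X → FreeMagma X → Prop) : Prop where
  wellOrder : IsWellOrder {w : FreeMagma X // IsBasic r w} (fun u v => r u.1 v.1)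
  weight_lt : ∀ u v : FreeMagma X, IsBasic r u → IsBasic r v → u.length < v.length → r u v

/-- The set of basic commutators, as elements of the free Lie algebra on `X`, for the order `r`. -/
def basicCommutators (K : Type*) [CommRing K] {X : Type*}
    (r : FreeMagma X → FreeMagma X → Prop) : Set (FreeLieAlgebra K X) :=
  commutatorValue K '' {w : FreeMagma X | IsBasic r w}

end FreeLieDensity

end

/-!
The argument rests on two facts about a free Lie algebra `L` over a field, graded by weight.

* An irredundant set of homogeneous elements (none lies in the Lie subalgebra generated by the
  others) is free: `IsIrredundant.isFreeFamily`. The proof starts with the free generating set `X`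
  and works through the weights. In weight `n`, the elements of the given set are exchanged, one by
  one, for members of the current free set, and the other members `r` of weight `n` are then removed
  by Lazard elimination, which replaces the remaining members `b` by all `[r, [r, …, [r, b]]]`. This
  leaves the subalgebra unchanged in weights greater than `n`. Elimination itself
  (`IsFreeFamily.iteratedLie`) comes from the action of a free Lie algebra by derivations on another
  free Lie algebra, and needs neither enveloping algebras nor linear independence of the basic
  commutators.
* The basic commutators of weight `n` span the component `L_n`
  (`homogeneousComponent_le_span_isBasic`), by the collecting process.

Write `S n` for the dimension of `L / L_{>n}`. Basic commutators are now chosen greedily, weight by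
weight: in weight `n` as few as possible are added to those chosen before, outside the subalgebra
that is already generated, such that the subalgebra `M` generated by all of them has dimension at
least `τ n = ⌊α (S n - S 1)⌋` modulo `L_{>n}` (`exists_greedy_sequence`). The dimension is exactly
`τ n` whenever something had to be added, so the density of `M` is `α` as soon as something is added
infinitely often.

If `α > 0`, this must be the case, since a finitely generated subalgebra `M` of this kind has
dimensions too small for positive density (`not_forall_mul_finrank_le`). Nothing was chosen in
weight `1`, so a metabelian quotient of `L` shows that `M` misses elements `z` of arbitrarily large
weight; such a `z`, of weight `w` say, is free over the generators of `M`. Let `U n` be the number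
of words of weight at most `n` in these generators. Modulo `L_{>n}`, the dimension of `M` is at most
`U n`. The iterated brackets `s · z` of words `s` on `z` are free, so their brackets
`[s · z, t · z]` are linearly independent, which yields `S (n + 2 w) ≥ h (U n - c)` for every `h`,
with a constant `c` that depends on `h`. A positive density would make `U` grow faster than any
exponential function, but `U n ≤ (q + 1) ^ n` for `q` generators.
-/

noncomputable section

namespace FreeLieDensity

open Finset

/-! ### Free families and Lazard elimination -/

section Free

variable {K : Type*} [Field K] {L : Type*} [LieRing L] [LieAlgebra K L]

open LieAlgebra TensorProduct

/-- The coefficient of `t ^ n` of an element of `K[t] ⊗ L`, where `K[t]` is encoded as the additive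
monoid algebra of `ℕ`. -/
def loopCoeff (K L : Type*) [Field K] [LieRing L] [LieAlgebra K L] (n : ℕ) :
    loopAlgebra K ℕ L →ₗ[K] L :=
  Finsupp.lapply n ∘ₗ (LoopAlgebra.toFinsupp K ℕ L).toLinearMap

theorem loopCoeff_single_tmul (n m : ℕ) (x : L) :
    loopCoeff K L n (AddMonoidAlgebra.single m 1 ⊗ₜ[K] x) = if m = n then x else 0 := by
  simp [loopCoeff, Finsupp.single_apply]

theorem loopAlgebra_induction {P : loopAlgebra K ℕ L → Prop} (h0 : P 0)
    (hadd : ∀ a b, P a → P b → P (a + b))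
    (hs : ∀ m x, P (AddMonoidAlgebra.single m 1 ⊗ₜ[K] x)) (a : loopAlgebra K ℕ L) : P a := by
  suffices H : ∀ f : ℕ →₀ L, P ((LoopAlgebra.toFinsupp K ℕ L).symm f) by
    simpa using H (LoopAlgebra.toFinsupp K ℕ L a)
  intro f
  induction f using Finsupp.induction_linear with
  | zero => simpa using h0
  | add f g hf hg => simpa using hadd _ _ hf hg
  | single m x => simpa using hs m x

theorem loopCoeff_lie (n : ℕ) (a b : loopAlgebra K ℕ L) :
    loopCoeff K L n ⁅a, b⁆ =
      ∑ ij ∈ antidiagonal n, ⁅loopCoeff K L ij.1 a, loopCoeff K L ij.2 b⁆ := by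
  induction a using loopAlgebra_induction with
  | h0 =>
    have h : ⁅(0 : loopAlgebra K ℕ L), b⁆ = 0 := zero_lie b
    simp [h]
  | hadd a a' ha ha' =>
    have h : ⁅a + a', b⁆ = ⁅a, b⁆ + ⁅a', b⁆ := add_lie a a' b
    simp only [h, map_add, add_lie, ha, ha', sum_add_distrib]
  | hs m x =>
    induction b using loopAlgebra_induction with
    | h0 =>
      have h (a : loopAlgebra K ℕ L) : ⁅a, (0 : loopAlgebra K ℕ L)⁆ = 0 := lie_zero a
      simp [h]
    | hadd b b' hb hb' =>
      have h (a : loopAlgebra K ℕ L) : ⁅a, b + b'⁆ = ⁅a, b⁆ + ⁅a, b'⁆ := lie_add a b b'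
      simp only [h, map_add, lie_add, hb, hb', sum_add_distrib]
    | hs k y =>
      rw [ExtendScalars.bracket_tmul, AddMonoidAlgebra.single_mul_single, one_mul]
      simp only [loopCoeff_single_tmul]
      by_cases h : m + k = n
      · rw [if_pos h, sum_eq_single (m, k)]
        · simp
        · rintro ⟨i, j⟩ hij hne
          by_cases h1 : m = i
          · by_cases h2 : k = j
            · exact absurd (by simp [h1, h2]) hne
            · simp [h2]
          · simp [h1]
        · intro h'
          exact absurd (mem_antidiagonal.2 h) h'
      · rw [if_neg h, sum_eq_zero]
        rintro ⟨i, j⟩ hij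
        by_cases h1 : m = i
        · by_cases h2 : k = j
          · subst h1 h2
            exact absurd (mem_antidiagonal.1 hij) h
          · simp [h2]
        · simp [h1]

/-- A family of elements of a Lie algebra is free if the Lie subalgebra generated by it is free
on the family. -/
def IsFreeFamily (K : Type*) [Field K] {L : Type*} [LieRing L] [LieAlgebra K L] {ι : Type*}
    (g : ι → L) : Prop :=
  Function.Injective (FreeLieAlgebra.lift K g)

variable {ι κ : Type*}

/-- The homomorphism `of i ↦ 1 ⊗ of i + t ⊗ f i`, which encodes a derivation in its coefficient
of `t`. -/
def derivationHom (f : ι → FreeLieAlgebra K ι) :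
    FreeLieAlgebra K ι →ₗ⁅K⁆ loopAlgebra K ℕ (FreeLieAlgebra K ι) :=
  FreeLieAlgebra.lift K fun i =>
    AddMonoidAlgebra.single 0 1 ⊗ₜ[K] FreeLieAlgebra.of K i +
      AddMonoidAlgebra.single 1 1 ⊗ₜ[K] f i

/-- A free Lie algebra is generated by its generators: the induction principle, obtained from the
universal property. -/
theorem freeLieAlgebra_induction {P : FreeLieAlgebra K ι → Prop}
    (hof : ∀ i, P (FreeLieAlgebra.of K i)) (hadd : ∀ a b, P a → P b → P (a + b))
    (hsmul : ∀ (c : K) a, P a → P (c • a)) (h0 : P 0) (hlie : ∀ a b, P a → P b → P ⁅a, b⁆)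
    (a : FreeLieAlgebra K ι) : P a := by
  let S : LieSubalgebra K (FreeLieAlgebra K ι) :=
    { carrier := {a | P a}
      add_mem' := fun {a b} ha hb => hadd a b ha hb
      zero_mem' := h0
      smul_mem' := fun c a ha => hsmul c a ha
      lie_mem' := fun {a b} ha hb => hlie a b ha hb }
  let F : FreeLieAlgebra K ι →ₗ⁅K⁆ S :=
    FreeLieAlgebra.lift K fun i => ⟨FreeLieAlgebra.of K i, hof i⟩
  have h : S.incl.comp F = LieHom.id := by
    ext i
    simp [F]
  have h2 : (S.incl.comp F) a = a := by rw [h]; rfl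
  rw [← h2]
  exact (F a).2

theorem loopCoeff_zero_derivationHom (f : ι → FreeLieAlgebra K ι) (a : FreeLieAlgebra K ι) :
    loopCoeff K _ 0 (derivationHom f a) = a := by
  induction a using freeLieAlgebra_induction with
  | hof i => simp [derivationHom, loopCoeff_single_tmul]
  | hadd a b ha hb => simp [ha, hb]
  | hsmul c a ha => simp [ha]
  | h0 => simp
  | hlie a b ha hb => simp [loopCoeff_lie, ha, hb]

/-- The derivation of a free Lie algebra with prescribed values on the generators. -/
def freeDerivation (f : ι → FreeLieAlgebra K ι) :
    LieDerivation K (FreeLieAlgebra K ι) (FreeLieAlgebra K ι) where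
  toLinearMap := loopCoeff K _ 1 ∘ₗ (derivationHom f : FreeLieAlgebra K ι →ₗ[K] _)
  leibniz' a b := by
    have h : antidiagonal 1 = {(0, 1), (1, 0)} := rfl
    simp only [LinearMap.comp_apply, LieHom.coe_toLinearMap, LieHom.map_lie, loopCoeff_lie, h]
    rw [sum_pair (by simp), loopCoeff_zero_derivationHom, loopCoeff_zero_derivationHom,
      ← lie_skew b, sub_eq_add_neg, neg_neg]

theorem freeDerivation_of (f : ι → FreeLieAlgebra K ι) (i : ι) :
    freeDerivation f (FreeLieAlgebra.of K i) = f i := by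
  change loopCoeff K _ 1 (derivationHom f _) = _
  simp [derivationHom, loopCoeff_single_tmul]

/-- The iterated bracket `[g a₁, [g a₂, … [g aₖ, x]]]` of a word `a₁ a₂ … aₖ` on `x`. -/
def iteratedLie (g : ι → L) (s : List ι) (x : L) : L :=
  s.foldr (fun a y => ⁅g a, y⁆) x

@[simp] theorem iteratedLie_nil (g : ι → L) (x : L) : iteratedLie g [] x = x := rfl

@[simp] theorem iteratedLie_cons (g : ι → L) (a : ι) (s : List ι) (x : L) :
    iteratedLie g (a :: s) x = ⁅g a, iteratedLie g s x⁆ := rfl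

theorem map_iteratedLie {L' : Type*} [LieRing L'] [LieAlgebra K L'] (F : L →ₗ⁅K⁆ L')
    (g : ι → L) (s : List ι) (x : L) :
    F (iteratedLie g s x) = iteratedLie (F ∘ g) s (F x) := by
  induction s with
  | nil => rfl
  | cons a s ih => simp [ih]

/-- **Lazard elimination**: if the elements `g (inl a)` are eliminated from a free family, then
the iterated brackets of the eliminated elements on the remaining ones are free. -/
theorem IsFreeFamily.iteratedLie {g : ι ⊕ κ → L} (hg : IsFreeFamily K g) :
    IsFreeFamily K fun q : List ι × κ => iteratedLie (g ∘ Sum.inl) q.1 (g (Sum.inr q.2)) := by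
  -- The letters `a` act on the free Lie algebra `G` on all pairs `(s, b)` by the derivations
  -- `(s, b) ↦ (a :: s, b)`; in the semidirect sum, the iterated bracket of `s` on `b` is `(s, b)`.
  set G := FreeLieAlgebra K (List ι × κ)
  let ψ : LieDerivation K G G →ₗ⁅K⁆ LieDerivation K G G := LieHom.id
  let D : ι → LieDerivation K G G := fun a =>
    freeDerivation fun q => FreeLieAlgebra.of K (a :: q.1, q.2)
  let φ : FreeLieAlgebra K (ι ⊕ κ) →ₗ⁅K⁆ (G ⋊⁅ψ⁆ LieDerivation K G G) :=
    FreeLieAlgebra.lift K (Sum.elim (fun a => ⟨0, D a⟩) fun b => ⟨FreeLieAlgebra.of K ([], b), 0⟩)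
  let f : List ι × κ → FreeLieAlgebra K (ι ⊕ κ) := fun q =>
    FreeLieDensity.iteratedLie (FreeLieAlgebra.of K ∘ Sum.inl) q.1
      (FreeLieAlgebra.of K (Sum.inr q.2))
  have hφ : ∀ q, φ (f q) = SemiDirectSum.inl ψ (FreeLieAlgebra.of K q) := by
    rintro ⟨s, b⟩
    simp only [f, SemiDirectSum.inl_eq_mk]
    induction s with
    | nil => simp [φ]
    | cons a s ih =>
      rw [iteratedLie_cons, LieHom.map_lie, ih]
      have h1 : φ (FreeLieAlgebra.of K (Sum.inl a)) = ⟨0, D a⟩ := by simp [φ]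
      rw [Function.comp_apply, h1, SemiDirectSum.lie_eq_mk]
      simpa [ψ, D] using freeDerivation_of _ _
  have h1 : φ.comp (FreeLieAlgebra.lift K f) = SemiDirectSum.inl ψ := by
    ext1 q
    simp [hφ]
  have h2 : Function.Injective (FreeLieAlgebra.lift K f) := by
    apply Function.Injective.of_comp (f := φ)
    rw [← LieHom.coe_comp, h1]
    exact SemiDirectSum.inl_injective ψ
  have h3 : FreeLieAlgebra.lift K (fun q : List ι × κ =>
      FreeLieDensity.iteratedLie (g ∘ Sum.inl) q.1 (g (Sum.inr q.2))) =
      (FreeLieAlgebra.lift K g).comp (FreeLieAlgebra.lift K f) := by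
    ext1 q
    simp only [f, FreeLieAlgebra.lift_of_apply, LieHom.comp_apply, map_iteratedLie]
    congr 1
    ext i
    simp
  unfold IsFreeFamily
  rw [h3, LieHom.coe_comp]
  exact hg.comp h2

/-- A subfamily of a free family is free: send the other generators to `0`. -/
theorem IsFreeFamily.comp_injective {g : ι → L} (hg : IsFreeFamily K g) {e : κ → ι}
    (he : Function.Injective e) : IsFreeFamily K (g ∘ e) := by
  classical
  let F : FreeLieAlgebra K κ →ₗ⁅K⁆ FreeLieAlgebra K ι :=
    FreeLieAlgebra.lift K (FreeLieAlgebra.of K ∘ e)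
  let F' : FreeLieAlgebra K ι →ₗ⁅K⁆ FreeLieAlgebra K κ :=
    FreeLieAlgebra.lift K fun i =>
      if h : ∃ k, e k = i then FreeLieAlgebra.of K h.choose else 0
  have h1 : F'.comp F = LieHom.id := by
    ext k
    have hk : ∃ k', e k' = e k := ⟨k, rfl⟩
    have : F' (FreeLieAlgebra.of K (e k)) = FreeLieAlgebra.of K k := by
      simp only [F', FreeLieAlgebra.lift_of_apply]
      rw [dif_pos hk, he hk.choose_spec]
    simpa [F] using this
  have h2 : Function.Injective F := by
    apply Function.Injective.of_comp (f := F')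
    rw [← LieHom.coe_comp, h1]
    exact fun _ _ h => h
  have h3 : FreeLieAlgebra.lift K (g ∘ e) = (FreeLieAlgebra.lift K g).comp F := by
    ext k
    simp [F]
  unfold IsFreeFamily
  rw [h3, LieHom.coe_comp]
  exact hg.comp h2

theorem eq_self_of_mem_lieSpan {S : Set L} (F : L →ₗ⁅K⁆ L) (hF : ∀ x ∈ S, F x = x) {w : L}
    (hw : w ∈ LieSubalgebra.lieSpan K L S) : F w = w := by
  induction hw using LieSubalgebra.lieSpan_induction with
  | mem x hx => exact hF x hx
  | zero => simp
  | add x y _ _ hx hy => simp [hx, hy]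
  | smul c x _ hx => simp [hx]
  | lie x y _ _ hx hy => simp [hx, hy]

/-- Replacing a member `g i` of a free family by `c • g i + w`, with `c ≠ 0` and `w` generated by
the other members, is induced by an automorphism of the free Lie algebra. -/
theorem IsFreeFamily.update [DecidableEq ι] {g : ι → L} (hg : IsFreeFamily K g) (i : ι) {c : K}
    (hc : c ≠ 0) {w : L} (hw : w ∈ LieSubalgebra.lieSpan K L (g '' {i}ᶜ)) :
    IsFreeFamily K (Function.update g i (c • g i + w)) := by
  have hw' : w ∈ (LieSubalgebra.lieSpan K _ (FreeLieAlgebra.of K '' {i}ᶜ)).map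
      (FreeLieAlgebra.lift K g) := by
    rw [LieSubalgebra.map_lieSpan, Set.image_image]
    simpa using hw
  obtain ⟨v, hv, rfl⟩ := hw'
  let F : FreeLieAlgebra K ι →ₗ⁅K⁆ FreeLieAlgebra K ι :=
    FreeLieAlgebra.lift K
      (Function.update (FreeLieAlgebra.of K) i (c • FreeLieAlgebra.of K i + v))
  let F' : FreeLieAlgebra K ι →ₗ⁅K⁆ FreeLieAlgebra K ι :=
    FreeLieAlgebra.lift K
      (Function.update (FreeLieAlgebra.of K) i (c⁻¹ • (FreeLieAlgebra.of K i - v)))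
  have hF'v : F' v = v := by
    refine eq_self_of_mem_lieSpan F' ?_ hv
    rintro _ ⟨j, hj, rfl⟩
    have hj' : j ≠ i := hj
    simp [F', hj']
  have h1 : F'.comp F = LieHom.id := by
    ext j
    by_cases hj : j = i
    · subst hj
      simp [F, hF'v]
      simp [F', smul_smul, hc]
    · simp [F, F', hj]
  have h2 : Function.Injective F := by
    apply Function.Injective.of_comp (f := F')
    rw [← LieHom.coe_comp, h1]
    exact fun _ _ h => h
  have h3 : FreeLieAlgebra.lift K
      (Function.update g i (c • g i + FreeLieAlgebra.lift K g v)) =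
      (FreeLieAlgebra.lift K g).comp F := by
    ext j
    by_cases hj : j = i
    · subst hj; simp [F]
    · simp [F, hj]
  change IsFreeFamily K (Function.update g i (c • g i + FreeLieAlgebra.lift K g v))
  unfold IsFreeFamily
  rw [h3, LieHom.coe_comp]
  exact hg.comp h2

attribute [local instance] LieRing.ofAssociativeRing LieAlgebra.ofAssociativeAlgebra

/-- A family with a dual family of linear forms is linearly independent. -/
theorem linearIndependent_of_dual_family {V : Type*} [AddCommGroup V] [Module K V] (v : ι → V)
    (φ : ι → V →ₗ[K] K) (h1 : ∀ i, φ i (v i) = 1) (h0 : ∀ i j, i ≠ j → φ i (v j) = 0) :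
    LinearIndependent K v := by
  rw [linearIndependent_iff]
  intro l hl
  ext i
  have h := congrArg (φ i) hl
  rw [Finsupp.linearCombination_apply, Finsupp.sum, map_sum, map_zero] at h
  simp only [map_smul] at h
  rw [Finset.sum_eq_single i] at h
  · simpa [h1] using h
  · intro j _ hj
    simp [h0 i j hj.symm]
  · intro hi
    simp [Finsupp.notMem_support_iff.1 hi]

/-- The generators are linearly independent: map one of them to a matrix unit and the others
to `0`. -/
theorem linearIndependent_of : LinearIndependent K (FreeLieAlgebra.of K : ι → _) := by
  classical
  let F : ι → (FreeLieAlgebra K ι →ₗ⁅K⁆ Matrix (Fin 2) (Fin 2) K) := fun i =>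
    FreeLieAlgebra.lift K fun j => if j = i then Matrix.single 0 1 1 else 0
  refine linearIndependent_of_dual_family _
    (fun i => Matrix.entryLinearMap K K (0 : Fin 2) (1 : Fin 2) ∘ₗ
      (F i : FreeLieAlgebra K ι →ₗ[K] _)) ?_ ?_
  · intro i; simp [F]
  · intro i j hij
    simp [F, hij.symm]

theorem IsFreeFamily.linearIndependent {g : ι → L} (hg : IsFreeFamily K g) :
    LinearIndependent K g := by
  have h := (linearIndependent_of (K := K) (ι := ι)).map_injOn
    (FreeLieAlgebra.lift K g : FreeLieAlgebra K ι →ₗ[K] L) hg.injOn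
  simpa [Function.comp_def] using h

/-- Brackets of distinct elements of a free family are linearly independent, provided that of
`[x, y]` and `[y, x]` at most one occurs. -/
theorem IsFreeFamily.linearIndependent_lie {g : ι → L} (hg : IsFreeFamily K g)
    (P : Set (ι × ι)) (hP : ∀ s t, (s, t) ∈ P → (t, s) ∉ P) :
    LinearIndependent K fun q : P => ⁅g q.1.1, g q.1.2⁆ := by
  classical
  -- `F (s, t)` maps `s` and `t` to `E₁₂` and `E₂₃`, hence `[s, t]` to `E₁₃`
  let F : ι × ι → (FreeLieAlgebra K ι →ₗ⁅K⁆ Matrix (Fin 3) (Fin 3) K) := fun q =>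
    FreeLieAlgebra.lift K fun j =>
      if j = q.1 then Matrix.single 0 1 1 else if j = q.2 then Matrix.single 1 2 1 else 0
  have hne : ∀ s t, (s, t) ∈ P → s ≠ t := by
    rintro s t h rfl
    exact hP _ _ h h
  have key : LinearIndependent K fun q : P =>
      ⁅FreeLieAlgebra.of K q.1.1, FreeLieAlgebra.of K q.1.2⁆ := by
    refine linearIndependent_of_dual_family _
      (fun q => Matrix.entryLinearMap K K (0 : Fin 3) (2 : Fin 3) ∘ₗ
        (F q.1 : FreeLieAlgebra K ι →ₗ[K] _)) ?_ ?_
    · rintro ⟨⟨s, t⟩, hq⟩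
      have := hne _ _ hq
      simp [F, this.symm, LieRing.of_associative_ring_bracket]
    · rintro ⟨⟨s, t⟩, hq⟩ ⟨⟨s', t'⟩, hq'⟩ hij
      have h1 := hne _ _ hq
      have h2 := hne _ _ hq'
      have h3 : ¬ (s' = t ∧ t' = s) := by
        rintro ⟨rfl, rfl⟩
        exact hP _ _ hq hq'
      have h4 : ¬ (s' = s ∧ t' = t) := by
        rintro ⟨rfl, rfl⟩
        exact hij rfl
      simp only [F, LinearMap.comp_apply, LieHom.coe_toLinearMap, LieHom.map_lie,
        FreeLieAlgebra.lift_of_apply, LieRing.of_associative_ring_bracket]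
      split_ifs <;> simp_all
  have h := key.map_injOn (FreeLieAlgebra.lift K g : FreeLieAlgebra K ι →ₗ[K] L) hg.injOn
  simpa [Function.comp_def] using h

end Free

/-! ### The weight grading of a free Lie algebra -/

section Grading

open LieAlgebra TensorProduct

variable {K : Type*} [Field K] {X : Type*}

local notation "𝓛" => FreeLieAlgebra K X
local notation "𝓗" => homogeneousComponent K X

theorem homogeneousComponent_zero : 𝓗 0 = ⊥ := by
  rw [homogeneousComponent, Submodule.span_eq_bot]
  rintro _ ⟨w, hw, rfl⟩
  have := FreeMagma.length_pos w
  simp only [Set.mem_ofPred_eq] at hw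
  omega

theorem commutatorValue_mem (w : FreeMagma X) : commutatorValue K w ∈ 𝓗 w.length :=
  Submodule.subset_span ⟨w, rfl, rfl⟩

theorem of_mem_homogeneousComponent (x : X) : FreeLieAlgebra.of K x ∈ 𝓗 1 :=
  commutatorValue_mem (FreeMagma.of x)

theorem lie_mem_homogeneousComponent {m n : ℕ} {x y : 𝓛} (hx : x ∈ 𝓗 m) (hy : y ∈ 𝓗 n) :
    ⁅x, y⁆ ∈ 𝓗 (m + n) := by
  induction hx, hy using Submodule.span_induction₂ with
  | mem_mem x y hx hy =>
    obtain ⟨u, rfl, rfl⟩ := hx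
    obtain ⟨v, rfl, rfl⟩ := hy
    exact commutatorValue_mem (u.mul v)
  | zero_left => simp
  | zero_right => simp
  | add_left _ _ _ _ _ _ h1 h2 => rw [add_lie]; exact add_mem h1 h2
  | add_right _ _ _ _ _ _ h1 h2 => rw [lie_add]; exact add_mem h1 h2
  | smul_left c _ _ _ _ h => rw [smul_lie]; exact Submodule.smul_mem _ _ h
  | smul_right c _ _ _ _ h => rw [lie_smul]; exact Submodule.smul_mem _ _ h

/-- The homomorphism `L → K[t] ⊗ L` that multiplies the elements of weight `n` by `t ^ n`. -/
def weightHom (K X : Type*) [Field K] :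
    FreeLieAlgebra K X →ₗ⁅K⁆ loopAlgebra K ℕ (FreeLieAlgebra K X) :=
  FreeLieAlgebra.lift K fun x => AddMonoidAlgebra.single 1 1 ⊗ₜ[K] FreeLieAlgebra.of K x

theorem weightHom_of_mem {n : ℕ} {x : 𝓛} (hx : x ∈ 𝓗 n) :
    weightHom K X x = AddMonoidAlgebra.single n 1 ⊗ₜ[K] x := by
  induction hx using Submodule.span_induction with
  | mem x h =>
    obtain ⟨w, rfl, rfl⟩ := h
    induction w with
    | ih1 x =>
      change weightHom K X (FreeLieAlgebra.of K x) =
        AddMonoidAlgebra.single 1 1 ⊗ₜ[K] FreeLieAlgebra.of K x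
      simp [weightHom]
    | ih2 u v hu hv =>
      change weightHom K X ⁅commutatorValue K u, commutatorValue K v⁆ =
        AddMonoidAlgebra.single (u.length + v.length) 1 ⊗ₜ[K]
          ⁅commutatorValue K u, commutatorValue K v⁆
      rw [LieHom.map_lie, hu, hv, ExtendScalars.bracket_tmul,
        AddMonoidAlgebra.single_mul_single, one_mul]
  | zero => simp
  | add x y _ _ hx hy => rw [map_add, hx, hy, tmul_add]
  | smul c x _ hx => rw [map_smul, hx, tmul_smul]

/-- The projection of the free Lie algebra onto its component of weight `n`. -/
def weightProj (K X : Type*) [Field K] (n : ℕ) : FreeLieAlgebra K X →ₗ[K] FreeLieAlgebra K X :=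
  loopCoeff K _ n ∘ₗ (weightHom K X : FreeLieAlgebra K X →ₗ[K] _)

theorem weightProj_of_mem {m : ℕ} {x : 𝓛} (hx : x ∈ 𝓗 m) (n : ℕ) :
    weightProj K X n x = if m = n then x else 0 := by
  change loopCoeff K _ n (weightHom K X x) = _
  rw [weightHom_of_mem hx, loopCoeff_single_tmul]

theorem weightProj_self {n : ℕ} {x : 𝓛} (hx : x ∈ 𝓗 n) : weightProj K X n x = x := by
  rw [weightProj_of_mem hx, if_pos rfl]

theorem weightProj_ne {m n : ℕ} {x : 𝓛} (hx : x ∈ 𝓗 m) (h : m ≠ n) : weightProj K X n x = 0 := by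
  rw [weightProj_of_mem hx, if_neg h]

theorem eq_of_mem_homogeneousComponent {m n : ℕ} {x : 𝓛} (hx : x ∈ 𝓗 m) (hx' : x ∈ 𝓗 n)
    (h0 : x ≠ 0) : m = n := by
  by_contra h
  exact h0 (by rw [← weightProj_self hx', weightProj_ne hx h])

theorem ne_zero_of_mem_homogeneousComponent {n : ℕ} {x : 𝓛} (hx : x ∈ 𝓗 n) (h0 : x ≠ 0) :
    n ≠ 0 := by
  rintro rfl
  rw [homogeneousComponent_zero, Submodule.mem_bot] at hx
  exact h0 hx

/-- A Lie subalgebra generated by homogeneous elements lies in any sum of subspaces that respects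
brackets and contains the generators. -/
theorem lieSpan_le_iSup {L : Type*} [LieRing L] [LieAlgebra K L] {B : Set L}
    (N : ℕ → Submodule K L)
    (hN : ∀ i j, ∀ x ∈ N i, ∀ y ∈ N j, ⁅x, y⁆ ∈ N (i + j)) (hB : ∀ b ∈ B, ∃ k, b ∈ N k) :
    (LieSubalgebra.lieSpan K L B).toSubmodule ≤ ⨆ n, N n := by
  have hlie : ∀ x ∈ ⨆ n, N n, ∀ y ∈ ⨆ n, N n, ⁅x, y⁆ ∈ ⨆ n, N n := by
    intro x hx y hy
    induction hx using Submodule.iSup_induction' with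
    | mem i x hx =>
      induction hy using Submodule.iSup_induction' with
      | mem j y hy => exact Submodule.mem_iSup_of_mem _ (hN i j x hx y hy)
      | zero => simp
      | add y z _ _ hy hz => rw [lie_add]; exact add_mem hy hz
    | zero => simp
    | add y z _ _ hy hz => rw [add_lie]; exact add_mem hy hz
  let S : LieSubalgebra K L := { (⨆ n, N n : Submodule K L) with
    lie_mem' := fun {x y} hx hy => hlie x hx y hy }
  have : LieSubalgebra.lieSpan K L B ≤ S := by
    rw [LieSubalgebra.lieSpan_le]
    intro b hb
    obtain ⟨k, hk⟩ := hB b hb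
    exact Submodule.mem_iSup_of_mem k hk
  exact this

theorem weightProj_mem_of_mem_iSup {N : ℕ → Submodule K 𝓛} (hN : ∀ i, N i ≤ 𝓗 i) {x : 𝓛}
    (hx : x ∈ ⨆ n, N n) (n : ℕ) : weightProj K X n x ∈ N n := by
  induction hx using Submodule.iSup_induction' with
  | mem i x hx =>
    rw [weightProj_of_mem (hN i hx)]
    split_ifs with h
    · exact h ▸ hx
    · exact zero_mem _
  | zero => simp
  | add x y _ _ hx hy => rw [map_add]; exact add_mem hx hy

theorem lieSpan_range_of : LieSubalgebra.lieSpan K 𝓛 (Set.range (FreeLieAlgebra.of K)) = ⊤ := by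
  rw [eq_top_iff]
  intro x _
  induction x using freeLieAlgebra_induction with
  | hof i => exact LieSubalgebra.subset_lieSpan ⟨i, rfl⟩
  | hadd a b ha hb => exact add_mem (ha trivial) (hb trivial)
  | hsmul c a ha => exact (LieSubalgebra.lieSpan K 𝓛 _).smul_mem c (ha trivial)
  | h0 => exact zero_mem _
  | hlie a b ha hb => exact LieSubalgebra.lie_mem _ (ha trivial) (hb trivial)

theorem mem_iSup_homogeneousComponent (x : 𝓛) : x ∈ ⨆ n, 𝓗 n := by
  have h := lieSpan_le_iSup (B := Set.range (FreeLieAlgebra.of K)) 𝓗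
    (fun i j x hx y hy => lie_mem_homogeneousComponent hx hy) (by
      rintro _ ⟨x, rfl⟩
      exact ⟨1, of_mem_homogeneousComponent x⟩)
  rw [lieSpan_range_of] at h
  exact h (LieSubalgebra.mem_top x)

theorem weightProj_mem (n : ℕ) (x : 𝓛) : weightProj K X n x ∈ 𝓗 n :=
  weightProj_mem_of_mem_iSup (fun _ => le_rfl) (mem_iSup_homogeneousComponent x) n

/-- The Lie subalgebra generated by a set of homogeneous elements is graded. -/
theorem weightProj_mem_lieSpan {B : Set 𝓛} (hB : ∀ b ∈ B, ∃ k, b ∈ 𝓗 k) {x : 𝓛}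
    (hx : x ∈ LieSubalgebra.lieSpan K 𝓛 B) (n : ℕ) :
    weightProj K X n x ∈ LieSubalgebra.lieSpan K 𝓛 B := by
  set M := LieSubalgebra.lieSpan K 𝓛 B with hM
  have h := lieSpan_le_iSup (B := B) (fun i => M.toSubmodule ⊓ 𝓗 i)
    (fun i j x hx y hy => ⟨M.lie_mem hx.1 hy.1, lie_mem_homogeneousComponent hx.2 hy.2⟩) (by
      intro b hb
      obtain ⟨k, hk⟩ := hB b hb
      exact ⟨k, LieSubalgebra.subset_lieSpan hb, hk⟩)
  exact (weightProj_mem_of_mem_iSup (fun i => inf_le_right) (h hx) n).1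

/-- If all generators outside `Z` have weight at least `n`, then, in weight `n`, brackets
contribute nothing beyond the subalgebra generated by `Z`. -/
theorem mem_span_sup_lieSpan {B Z : Set 𝓛} {n : ℕ} (hZ : ∀ b ∈ Z, ∃ k, b ∈ 𝓗 k)
    (hB : ∀ b ∈ B, b ∈ Z ∨ ∃ k, n ≤ k ∧ b ∈ 𝓗 k) {x : 𝓛}
    (hx : x ∈ LieSubalgebra.lieSpan K 𝓛 B) (hxn : x ∈ 𝓗 n) :
    x ∈ Submodule.span K {b ∈ B | b ∉ Z ∧ b ∈ 𝓗 n} ⊔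
      (LieSubalgebra.lieSpan K 𝓛 Z).toSubmodule := by
  classical
  set M := LieSubalgebra.lieSpan K 𝓛 Z
  set V := Submodule.span K {b ∈ B | b ∉ Z ∧ b ∈ 𝓗 n} ⊔ M.toSubmodule
  let N : ℕ → Submodule K 𝓛 := fun i =>
    if i < n then M.toSubmodule ⊓ 𝓗 i else if i = n then V ⊓ 𝓗 i else 𝓗 i
  have hN1 : ∀ i, N i ≤ 𝓗 i := by
    intro i
    simp only [N]
    split_ifs
    · exact inf_le_right
    · exact inf_le_right
    · exact le_rfl
  have hN2 : ∀ i, M.toSubmodule ⊓ 𝓗 i ≤ N i := by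
    intro i
    simp only [N]
    split_ifs
    · exact le_rfl
    · exact inf_le_inf_right _ le_sup_right
    · exact inf_le_right
  have hN3 : ∀ i j, ∀ x ∈ N i, ∀ y ∈ N j, ⁅x, y⁆ ∈ N (i + j) := by
    intro i j x hx y hy
    have hx' := hN1 i hx
    have hy' := hN1 j hy
    by_cases hx0 : x = 0
    · simp [hx0]
    by_cases hy0 : y = 0
    · simp [hy0]
    have hi := ne_zero_of_mem_homogeneousComponent hx' hx0
    have hj := ne_zero_of_mem_homogeneousComponent hy' hy0
    by_cases hij : i + j ≤ n
    · apply hN2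
      refine ⟨?_, lie_mem_homogeneousComponent hx' hy'⟩
      simp only [N] at hx hy
      rw [if_pos (by omega)] at hx hy
      exact M.lie_mem hx.1 hy.1
    · simp only [N]
      rw [if_neg (by omega), if_neg (by omega)]
      exact lie_mem_homogeneousComponent hx' hy'
  have h := lieSpan_le_iSup (B := B) N hN3 (by
    intro b hb
    by_cases hbZ : b ∈ Z
    · obtain ⟨k, hk⟩ := hZ b hbZ
      exact ⟨k, hN2 k ⟨LieSubalgebra.subset_lieSpan hbZ, hk⟩⟩
    · obtain ⟨k, hk, hbk⟩ := (hB b hb).resolve_left hbZ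
      refine ⟨k, ?_⟩
      simp only [N]
      rw [if_neg (by omega)]
      split_ifs with hkn
      · subst hkn
        exact ⟨Submodule.mem_sup_left (Submodule.subset_span ⟨hb, hbZ, hbk⟩), hbk⟩
      · exact hbk)
  have h2 := weightProj_mem_of_mem_iSup hN1 (h hx) n
  rw [weightProj_self hxn] at h2
  simp only [N, lt_irrefl, if_false, if_true] at h2
  exact h2.1

theorem sub_sum_weightProj_mem (n : ℕ) (x : 𝓛) :
    x - ∑ i ∈ range (n + 1), weightProj K X i x ∈ degreeGT 𝓗 n := by
  have hx := mem_iSup_homogeneousComponent x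
  induction hx using Submodule.iSup_induction' with
  | mem k x hx =>
    simp only [weightProj_of_mem hx]
    rw [sum_ite_eq]
    split_ifs with h
    · simp
    · rw [sub_zero]
      exact Submodule.mem_iSup_of_mem k (Submodule.mem_iSup_of_mem (by simpa using h) hx)
  | zero => simp
  | add x y _ _ hx hy =>
    simp only [map_add, sum_add_distrib]
    rw [add_sub_add_comm]
    exact add_mem hx hy

theorem weightProj_eq_zero_of_mem_degreeGT {n i : ℕ} (hi : i ≤ n) {x : 𝓛}
    (hx : x ∈ degreeGT 𝓗 n) : weightProj K X i x = 0 := by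
  suffices h : degreeGT 𝓗 n ≤ LinearMap.ker (weightProj K X i) from h hx
  refine iSup_le fun m => iSup_le fun hm => ?_
  intro y hy
  exact weightProj_ne hy (by omega)

theorem mem_degreeGT {n k : ℕ} (h : n < k) {x : 𝓛} (hx : x ∈ 𝓗 k) : x ∈ degreeGT 𝓗 n :=
  Submodule.mem_iSup_of_mem k (Submodule.mem_iSup_of_mem h hx)

theorem finite_setOf_length_eq [Finite X] (n : ℕ) : {w : FreeMagma X | w.length = n}.Finite := by
  induction n using Nat.strong_induction_on with
  | _ n ih =>
    have h : {w : FreeMagma X | w.length = n} ⊆ Set.range FreeMagma.of ∪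
        ⋃ i ∈ Set.Iio n, ⋃ j ∈ Set.Iio n, Set.image2 (· * ·)
          {w : FreeMagma X | w.length = i} {w : FreeMagma X | w.length = j} := by
      intro w hw
      cases w with
      | of x => exact Or.inl ⟨x, rfl⟩
      | mul u v =>
        right
        have hw' : u.length + v.length = n := hw
        have hu := FreeMagma.length_pos u
        have hv := FreeMagma.length_pos v
        simp only [Set.mem_iUnion]
        exact ⟨u.length, by simp only [Set.mem_Iio]; omega, v.length,
          by simp only [Set.mem_Iio]; omega, u, rfl, v, rfl, rfl⟩
    refine Set.Finite.subset ((Set.finite_range _).union ?_) h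
    refine Set.Finite.biUnion (Set.finite_Iio n) fun i hi => ?_
    refine Set.Finite.biUnion (Set.finite_Iio n) fun j hj => ?_
    exact Set.Finite.image2 _ (ih i hi) (ih j hj)

theorem finite_setOf_length_lt [Finite X] (n : ℕ) : {w : FreeMagma X | w.length < n}.Finite := by
  have h : {w : FreeMagma X | w.length < n} = ⋃ i ∈ Set.Iio n, {w | w.length = i} := by
    ext w
    simp
  rw [h]
  exact (Set.finite_Iio n).biUnion fun i _ => finite_setOf_length_eq i

instance finiteDimensional_homogeneousComponent [Finite X] (n : ℕ) :
    FiniteDimensional K (𝓗 n) :=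
  FiniteDimensional.span_of_finite K ((finite_setOf_length_eq n).image _)

/-- For a graded subalgebra `M`, the dimension of the image of `M` in `L / L_{>n}` is the sum of
the dimensions of the components of `M` of weight at most `n`. -/
theorem finrank_map_mkQ [Finite X] (M : LieSubalgebra K 𝓛)
    (hM : ∀ x ∈ M, ∀ n, weightProj K X n x ∈ M) (n : ℕ) :
    Module.finrank K (M.toSubmodule.map (degreeGT 𝓗 n).mkQ) =
      ∑ i ∈ range (n + 1), Module.finrank K (M.toSubmodule ⊓ 𝓗 i : Submodule K 𝓛) := by
  let f : (∀ i : Fin (n + 1), (M.toSubmodule ⊓ 𝓗 i : Submodule K 𝓛)) →ₗ[K] 𝓛 :=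
    ∑ i : Fin (n + 1), (Submodule.subtype _) ∘ₗ LinearMap.proj i
  have hf : ∀ v, f v = ∑ i, (v i : 𝓛) := by
    intro v
    simp [f]
  have hproj : ∀ v j, weightProj K X (j : Fin (n + 1)) (f v) = v j := by
    intro v j
    rw [hf, map_sum, Finset.sum_eq_single j]
    · exact weightProj_self (v j).2.2
    · intro i _ hij
      exact weightProj_ne (v i).2.2 (fun h => hij (Fin.ext h))
    · simp
  have hinj : Function.Injective ((degreeGT 𝓗 n).mkQ ∘ₗ f) := by
    rw [← LinearMap.ker_eq_bot, LinearMap.ker_eq_bot']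
    intro v hv
    rw [LinearMap.comp_apply, Submodule.mkQ_apply, Submodule.Quotient.mk_eq_zero] at hv
    ext j
    rw [← hproj, weightProj_eq_zero_of_mem_degreeGT (by omega) hv]
    rfl
  have hrange : LinearMap.range ((degreeGT 𝓗 n).mkQ ∘ₗ f) =
      M.toSubmodule.map (degreeGT 𝓗 n).mkQ := by
    apply le_antisymm
    · rintro _ ⟨v, rfl⟩
      refine ⟨f v, ?_, rfl⟩
      rw [hf]
      exact sum_mem fun i _ => (v i).2.1
    · rintro _ ⟨x, hx, rfl⟩
      refine ⟨fun i => ⟨weightProj K X i x, hM x hx i, weightProj_mem _ _⟩, ?_⟩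
      rw [LinearMap.comp_apply, hf, Submodule.mkQ_apply, Submodule.mkQ_apply, eq_comm,
        Submodule.Quotient.eq, Fin.sum_univ_eq_sum_range fun i => weightProj K X i x]
      exact sub_sum_weightProj_mem n x
  rw [← hrange, LinearMap.finrank_range_of_inj hinj, Module.finrank_pi_fintype,
    Fin.sum_univ_eq_sum_range fun i => Module.finrank K (M.toSubmodule ⊓ 𝓗 i : Submodule K 𝓛)]

theorem finrank_quotient_degreeGT [Finite X] (n : ℕ) :
    Module.finrank K (𝓛 ⧸ degreeGT 𝓗 n) = ∑ i ∈ range (n + 1), Module.finrank K (𝓗 i) := by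
  have h := finrank_map_mkQ (K := K) (X := X) ⊤ (fun _ _ _ => trivial) n
  rw [LieSubalgebra.top_toSubmodule, Submodule.map_top, Submodule.range_mkQ, finrank_top] at h
  rw [h]
  exact sum_congr rfl fun i _ => by rw [top_inf_eq]

instance finiteDimensional_quotient_degreeGT [Finite X] (n : ℕ) :
    FiniteDimensional K (𝓛 ⧸ degreeGT 𝓗 n) := by
  have h : (⊤ : Submodule K (𝓛 ⧸ degreeGT 𝓗 n)) ≤
      (⨆ i : Fin (n + 1), 𝓗 i : Submodule K 𝓛).map (degreeGT 𝓗 n).mkQ := by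
    intro y _
    obtain ⟨x, rfl⟩ := Submodule.mkQ_surjective _ y
    refine ⟨∑ i ∈ range (n + 1), weightProj K X i x, ?_, ?_⟩
    · refine sum_mem fun i hi => ?_
      exact Submodule.mem_iSup_of_mem (⟨i, by simpa using hi⟩ : Fin (n + 1)) (weightProj_mem i x)
    · rw [Submodule.mkQ_apply, Submodule.mkQ_apply, eq_comm, Submodule.Quotient.eq]
      exact sub_sum_weightProj_mem n x
  have h2 := Submodule.finiteDimensional_of_le h
  exact Module.finite_def.2 ((Submodule.fg_iff_finiteDimensional _).2 h2)

end Grading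

/-! ### Irredundant homogeneous sets are free -/

section FreeSets

variable {K : Type*} [Field K] {L : Type*} [LieRing L] [LieAlgebra K L]

theorem IsFreeFamily.mono {A B : Set L} (hB : IsFreeFamily K ((↑) : B → L)) (h : A ⊆ B) :
    IsFreeFamily K ((↑) : A → L) := by
  have h1 : ((↑) : A → L) = ((↑) : B → L) ∘ Set.inclusion h := rfl
  rw [h1]
  exact hB.comp_injective (Set.inclusion_injective h)

theorem IsFreeFamily.range {ι : Type*} {g : ι → L} (hg : IsFreeFamily K g) :
    IsFreeFamily K ((↑) : Set.range g → L) := by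
  let e : Set.range g → ι := fun x => x.2.choose
  have he : g ∘ e = (↑) := funext fun x => x.2.choose_spec
  have hinj : Function.Injective e := by
    apply Function.Injective.of_comp (f := g)
    rw [he]
    exact Subtype.val_injective
  rw [← he]
  exact hg.comp_injective hinj

/-- The exchange step, for sets instead of families. -/
theorem IsFreeFamily.exchange {B : Set L} (hB : IsFreeFamily K ((↑) : B → L)) {r : L} (hr : r ∈ B)
    {c : K} (hc : c ≠ 0) {w : L} (hw : w ∈ LieSubalgebra.lieSpan K L (B \ {r})) :
    IsFreeFamily K ((↑) : (insert (c • r + w) (B \ {r}) : Set L) → L) := by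
  classical
  have himg : ((↑) : B → L) '' {⟨r, hr⟩}ᶜ = B \ {r} := by
    ext x
    constructor
    · rintro ⟨⟨y, hy⟩, hne, rfl⟩
      exact ⟨hy, fun h => hne (Subtype.ext h)⟩
    · rintro ⟨hx, hne⟩
      exact ⟨⟨x, hx⟩, fun h => hne (congrArg Subtype.val h), rfl⟩
  refine (hB.update ⟨r, hr⟩ hc (w := w) (by rwa [himg])).range.mono ?_
  rintro x (rfl | ⟨hx, hne⟩)
  · exact ⟨⟨r, hr⟩, by simp⟩
  · refine ⟨⟨x, hx⟩, ?_⟩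
    rw [Function.update_of_ne]
    exact fun h => hne (congrArg Subtype.val h)

/-- The set obtained from `B` by eliminating `r`: it consists of all iterated brackets
`[r, [r, … [r, b]]]` with `b ∈ B` and `b ≠ r`. -/
def eliminate (B : Set L) (r : L) : Set L :=
  Set.range fun q : List Unit × (B \ {r} : Set L) => iteratedLie (fun _ => r) q.1 (q.2 : L)

theorem IsFreeFamily.eliminate {B : Set L} (hB : IsFreeFamily K ((↑) : B → L)) {r : L}
    (hr : r ∈ B) : IsFreeFamily K ((↑) : eliminate B r → L) := by
  let e : Unit ⊕ (B \ {r} : Set L) → B := Sum.elim (fun _ => ⟨r, hr⟩) fun b => ⟨b, b.2.1⟩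
  have he : Function.Injective e := by
    rintro (_ | ⟨a, ha⟩) (_ | ⟨b, hb⟩) h
    · rfl
    · exact absurd (congrArg Subtype.val h).symm hb.2
    · exact absurd (congrArg Subtype.val h) ha.2
    · have : a = b := congrArg Subtype.val h
      subst this
      rfl
  exact (hB.comp_injective he).iteratedLie.range

/-- Eliminating `r` shrinks the generated subalgebra by at most the line spanned by `r`. -/
theorem lieSpan_le_span_sup_eliminate (B : Set L) (r : L) :
    (LieSubalgebra.lieSpan K L B).toSubmodule ≤
      Submodule.span K {r} ⊔ (LieSubalgebra.lieSpan K L (eliminate B r)).toSubmodule := by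
  set M := LieSubalgebra.lieSpan K L (eliminate B r)
  have hr : ∀ x ∈ M, ⁅r, x⁆ ∈ M := by
    intro x hx
    induction hx using LieSubalgebra.lieSpan_induction with
    | mem x hx =>
      obtain ⟨⟨s, b⟩, rfl⟩ := hx
      exact LieSubalgebra.subset_lieSpan ⟨(() :: s, b), rfl⟩
    | zero => simp
    | add x y _ _ hx hy => rw [lie_add]; exact add_mem hx hy
    | smul c x _ hx => rw [lie_smul]; exact M.smul_mem c hx
    | lie x y hxM hyM hx hy =>
      rw [leibniz_lie]
      exact add_mem (M.lie_mem hx hyM) (M.lie_mem hxM hy)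
  let S : LieSubalgebra K L := { (Submodule.span K {r} ⊔ M.toSubmodule : Submodule K L) with
    lie_mem' := by
      intro x y hx hy
      obtain ⟨x₁, hx₁, x₂, hx₂, rfl⟩ := Submodule.mem_sup.1 hx
      obtain ⟨y₁, hy₁, y₂, hy₂, rfl⟩ := Submodule.mem_sup.1 hy
      obtain ⟨a, rfl⟩ := Submodule.mem_span_singleton.1 hx₁
      obtain ⟨b, rfl⟩ := Submodule.mem_span_singleton.1 hy₁
      apply Submodule.mem_sup_right
      simp only [add_lie, lie_add, smul_lie, lie_smul, lie_self, smul_zero, zero_add]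
      rw [← lie_skew x₂ r]
      exact add_mem (M.smul_mem b (neg_mem (hr _ hx₂)))
        (add_mem (M.smul_mem a (hr _ hy₂)) (M.lie_mem hx₂ hy₂)) }
  have : LieSubalgebra.lieSpan K L B ≤ S := by
    rw [LieSubalgebra.lieSpan_le]
    intro b hb
    by_cases hbr : b = r
    · exact Submodule.mem_sup_left (by rw [hbr]; exact Submodule.mem_span_singleton_self r)
    · exact Submodule.mem_sup_right (LieSubalgebra.subset_lieSpan ⟨([], ⟨b, hb, hbr⟩), rfl⟩)
  exact this

/-- The union of an increasing sequence of free sets is free. -/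
theorem isFreeFamily_iUnion {S : ℕ → Set L} (hS : Monotone S)
    (h : ∀ n, IsFreeFamily K ((↑) : S n → L)) : IsFreeFamily K ((↑) : (⋃ n, S n : Set L) → L) := by
  set Y := ⋃ n, S n
  let e : ∀ n, S n → Y := fun n => Set.inclusion (Set.subset_iUnion S n)
  let F : ∀ n, FreeLieAlgebra K (S n) →ₗ⁅K⁆ FreeLieAlgebra K Y := fun n =>
    FreeLieAlgebra.lift K (FreeLieAlgebra.of K ∘ e n)
  have hF : ∀ m n, m ≤ n → ∀ a, ∃ b, F n b = F m a := by
    intro m n hmn a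
    refine ⟨FreeLieAlgebra.lift K (FreeLieAlgebra.of K ∘ Set.inclusion (hS hmn)) a, ?_⟩
    have : (F n).comp (FreeLieAlgebra.lift K (FreeLieAlgebra.of K ∘ Set.inclusion (hS hmn))) =
        F m := by
      ext x
      simp [F, e]
    rw [← this]
    rfl
  have key : ∀ f : FreeLieAlgebra K Y, ∃ n a, F n a = f := by
    intro f
    induction f using freeLieAlgebra_induction with
    | hof y =>
      obtain ⟨n, hn⟩ := Set.mem_iUnion.1 y.2
      exact ⟨n, FreeLieAlgebra.of K ⟨y, hn⟩, by simp [F, e]⟩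
    | hadd f g hf hg =>
      obtain ⟨m, a, rfl⟩ := hf
      obtain ⟨n, b, rfl⟩ := hg
      obtain ⟨a', ha'⟩ := hF m _ (le_max_left m n) a
      obtain ⟨b', hb'⟩ := hF n _ (le_max_right m n) b
      exact ⟨max m n, a' + b', by rw [map_add, ha', hb']⟩
    | hsmul c f hf =>
      obtain ⟨m, a, rfl⟩ := hf
      exact ⟨m, c • a, by simp⟩
    | h0 => exact ⟨0, 0, by simp⟩
    | hlie f g hf hg =>
      obtain ⟨m, a, rfl⟩ := hf
      obtain ⟨n, b, rfl⟩ := hg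
      obtain ⟨a', ha'⟩ := hF m _ (le_max_left m n) a
      obtain ⟨b', hb'⟩ := hF n _ (le_max_right m n) b
      exact ⟨max m n, ⁅a', b'⁆, by rw [LieHom.map_lie, ha', hb']⟩
  unfold IsFreeFamily
  rw [injective_iff_map_eq_zero]
  intro f hf
  obtain ⟨n, a, rfl⟩ := key f
  have h1 : (FreeLieAlgebra.lift K ((↑) : Y → L)).comp (F n) =
      FreeLieAlgebra.lift K ((↑) : S n → L) := by
    ext x
    simp [F, e]
  have h2 : FreeLieAlgebra.lift K ((↑) : S n → L) a = 0 := by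
    rw [← h1]
    exact hf
  rw [(injective_iff_map_eq_zero _).1 (h n) a h2, map_zero]

end FreeSets

section Irredundant

variable {K : Type*} [Field K] {X : Type*}

local notation "𝓛" => FreeLieAlgebra K X
local notation "𝓗" => homogeneousComponent K X

/-- `B` is a free set of homogeneous elements that contains `Z`, whose elements outside `Z` have
weight at least `n`, and which generates a subalgebra containing all elements of weight at
least `m`. -/
structure IsAdapted (Z B : Set (FreeLieAlgebra K X)) (n m : ℕ) : Prop where
  free : IsFreeFamily K ((↑) : B → FreeLieAlgebra K X)
  subset : Z ⊆ B
  weight : ∀ b ∈ B, b ∈ Z ∨ ∃ k, n ≤ k ∧ b ∈ homogeneousComponent K X k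
  le_lieSpan : ∀ k, m ≤ k → homogeneousComponent K X k ≤
    (LieSubalgebra.lieSpan K (FreeLieAlgebra K X) B).toSubmodule

theorem finite_of_linearIndependent [Finite X] {S : Set 𝓛} {n : ℕ} (hS : ∀ x ∈ S, x ∈ 𝓗 n)
    (h : LinearIndependent K ((↑) : S → 𝓛)) : S.Finite := by
  have h2 : LinearIndependent K (fun x : S => (⟨x, hS x x.2⟩ : 𝓗 n)) :=
    LinearIndependent.of_comp (𝓗 n).subtype h
  exact Set.finite_coe_iff.1 (h2.finite)

theorem IsFreeFamily.ne_zero {L : Type*} [LieRing L] [LieAlgebra K L] {B : Set L}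
    (hB : IsFreeFamily K ((↑) : B → L)) {b : L} (hb : b ∈ B) : b ≠ 0 :=
  hB.linearIndependent.ne_zero ⟨b, hb⟩

theorem iteratedLie_mem {r : 𝓛} {n k : ℕ} (hr : r ∈ 𝓗 n) {b : 𝓛} (hb : b ∈ 𝓗 k)
    (s : List Unit) : iteratedLie (fun _ => r) s b ∈ 𝓗 (s.length * n + k) := by
  induction s with
  | nil => simpa using hb
  | cons a s ih =>
    have h := lie_mem_homogeneousComponent hr ih
    rw [iteratedLie_cons, List.length_cons]
    convert h using 2
    ring

/-- An element of a free generating set can be traded for an element of the same weight that is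
not generated by the part of the set which is to be kept. -/
theorem IsAdapted.exists_insert {Z B : Set 𝓛} {n : ℕ} (h : IsAdapted Z B n n)
    (hZ : ∀ b ∈ Z, ∃ k, b ∈ 𝓗 k) {c : 𝓛} (hc : c ∈ 𝓗 n)
    (hcZ : c ∉ LieSubalgebra.lieSpan K 𝓛 Z) : ∃ B', IsAdapted (insert c Z) B' n n := by
  set S := {b ∈ B | b ∉ Z ∧ b ∈ 𝓗 n}
  set V := LieSubalgebra.lieSpan K 𝓛 Z
  obtain ⟨ρ, hρ, v, hv, rfl⟩ :=
    Submodule.mem_sup.1 (mem_span_sup_lieSpan hZ h.weight (h.le_lieSpan n le_rfl hc) hc)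
  obtain ⟨l, rfl⟩ := (Finsupp.mem_span_iff_linearCombination K S ρ).1 hρ
  have hl : l ≠ 0 := by
    rintro rfl
    exact hcZ (by simpa using hv)
  obtain ⟨⟨r, hrB, hrZ, hrn⟩, hlr⟩ := Finsupp.support_nonempty_iff.2 hl
  set i : S := ⟨r, hrB, hrZ, hrn⟩
  have hlr : l i ≠ 0 := Finsupp.mem_support_iff.1 hlr
  have hZr : Z ⊆ B \ {r} := fun z hz => ⟨h.subset hz, fun hzr => hrZ (hzr ▸ hz)⟩
  have hw : Finsupp.linearCombination K ((↑) : S → 𝓛) (l.erase i) + v ∈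
      LieSubalgebra.lieSpan K 𝓛 (B \ {r}) := by
    refine add_mem ?_ (LieSubalgebra.lieSpan_mono hZr hv)
    rw [Finsupp.linearCombination_apply]
    refine sum_mem fun j hj => ?_
    refine (LieSubalgebra.lieSpan K 𝓛 (B \ {r})).smul_mem _ (LieSubalgebra.subset_lieSpan ?_)
    refine ⟨j.2.1, fun hjr => ?_⟩
    have : j = i := Subtype.ext hjr
    rw [this] at hj
    simp at hj
  have hsum : Finsupp.linearCombination K ((↑) : S → 𝓛) l + v =
      l i • r + (Finsupp.linearCombination K ((↑) : S → 𝓛) (l.erase i) + v) := by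
    conv_lhs => rw [← Finsupp.single_add_erase i l]
    rw [map_add, Finsupp.linearCombination_single, add_assoc]
  rw [hsum] at hc ⊢
  set w := Finsupp.linearCombination K ((↑) : S → 𝓛) (l.erase i) + v
  refine ⟨insert (l i • r + w) (B \ {r}), h.free.exchange hrB hlr hw,
    Set.insert_subset_insert hZr, ?_, fun k hk => (h.le_lieSpan k hk).trans ?_⟩
  · rintro b (rfl | ⟨hb, -⟩)
    · exact Or.inl (Set.mem_insert _ _)
    · exact (h.weight b hb).imp_left (Set.mem_insert_of_mem _)
  · have hle : LieSubalgebra.lieSpan K 𝓛 B ≤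
        LieSubalgebra.lieSpan K 𝓛 (insert (l i • r + w) (B \ {r})) := by
      rw [LieSubalgebra.lieSpan_le]
      intro b hb
      by_cases hbr : b = r
      · have h1 : l i • r + w ∈ LieSubalgebra.lieSpan K 𝓛 (insert (l i • r + w) (B \ {r})) :=
          LieSubalgebra.subset_lieSpan (Set.mem_insert _ _)
        have h2 : w ∈ LieSubalgebra.lieSpan K 𝓛 (insert (l i • r + w) (B \ {r})) :=
          LieSubalgebra.lieSpan_mono (Set.subset_insert _ _) hw
        have h3 := LieSubalgebra.smul_mem _ (l i)⁻¹ (sub_mem h1 h2)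
        rw [add_sub_cancel_right, smul_smul, inv_mul_cancel₀ hlr, one_smul] at h3
        rw [hbr]
        exact h3
      · exact LieSubalgebra.subset_lieSpan (Set.mem_insert_of_mem _ ⟨hb, hbr⟩)
    exact hle

/-- Eliminating an element of weight `n` outside `Z` makes the set of such elements smaller. -/
theorem IsAdapted.eliminate {Z B : Set 𝓛} {n : ℕ} (h : IsAdapted Z B n (n + 1))
    (hZ : ∀ b ∈ Z, ∃ k, b ∈ 𝓗 k) {r : 𝓛} (hr : r ∈ B) (hrZ : r ∉ Z) (hrn : r ∈ 𝓗 n) :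
    IsAdapted Z (eliminate B r) n (n + 1) ∧
      {b ∈ FreeLieDensity.eliminate B r | b ∉ Z ∧ b ∈ 𝓗 n} ⊆
        {b ∈ B | b ∉ Z ∧ b ∈ 𝓗 n} \ {r} := by
  have hn : n ≠ 0 := ne_zero_of_mem_homogeneousComponent hrn (h.free.ne_zero hr)
  have hweight : ∀ b ∈ FreeLieDensity.eliminate B r, (b ∈ B ∧ b ≠ r) ∨
      ∃ k, n + 1 ≤ k ∧ b ∈ 𝓗 k := by
    rintro _ ⟨⟨s, b, hb, hbr⟩, rfl⟩
    cases s with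
    | nil => exact Or.inl ⟨hb, hbr⟩
    | cons a s =>
      right
      have hb' : ∃ k, b ∈ 𝓗 k := by
        rcases h.weight b hb with h' | ⟨k, -, hk⟩
        · exact hZ b h'
        · exact ⟨k, hk⟩
      obtain ⟨k, hk⟩ := hb'
      have hk0 := ne_zero_of_mem_homogeneousComponent hk (h.free.ne_zero hb)
      refine ⟨_, ?_, iteratedLie_mem hrn hk (a :: s)⟩
      rw [List.length_cons, add_mul, one_mul]
      omega
  refine ⟨⟨h.free.eliminate hr, ?_, ?_, ?_⟩, ?_⟩
  · intro z hz
    exact ⟨([], ⟨z, h.subset hz, fun hzr => hrZ (hzr ▸ hz)⟩), rfl⟩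
  · intro b hb
    rcases hweight b hb with ⟨hbB, -⟩ | ⟨k, hk, hbk⟩
    · exact h.weight b hbB
    · exact Or.inr ⟨k, by omega, hbk⟩
  · intro k hk x hx
    obtain ⟨y, hy, v, hv, rfl⟩ :=
      Submodule.mem_sup.1 (lieSpan_le_span_sup_eliminate B r (h.le_lieSpan k hk hx))
    obtain ⟨a, rfl⟩ := Submodule.mem_span_singleton.1 hy
    have h1 := weightProj_self hx
    rw [map_add, map_smul, weightProj_ne hrn (by omega), smul_zero, zero_add] at h1
    rw [← h1]
    refine weightProj_mem_lieSpan ?_ hv k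
    intro b hb
    rcases hweight b hb with ⟨hbB, -⟩ | ⟨k, -, hbk⟩
    · rcases h.weight b hbB with h' | ⟨k, -, hk⟩
      · exact hZ b h'
      · exact ⟨k, hk⟩
    · exact ⟨k, hbk⟩
  · rintro b ⟨hb, hbZ, hbn⟩
    rcases hweight b hb with ⟨hbB, hbr⟩ | ⟨k, hk, hbk⟩
    · exact ⟨⟨hbB, hbZ, hbn⟩, hbr⟩
    · have := eq_of_mem_homogeneousComponent hbk hbn ((h.free.eliminate hr).ne_zero hb)
      omega

/-- The elements of weight `n` outside `Z` are finitely many, and can all be eliminated. -/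
theorem IsAdapted.exists_succ [Finite X] {Z B : Set 𝓛} {n : ℕ} (h : IsAdapted Z B n (n + 1))
    (hZ : ∀ b ∈ Z, ∃ k, b ∈ 𝓗 k) : ∃ B', IsAdapted Z B' (n + 1) (n + 1) := by
  have hfin : {b ∈ B | b ∉ Z ∧ b ∈ 𝓗 n}.Finite :=
    finite_of_linearIndependent (fun x hx => hx.2.2)
      (h.free.mono (Set.sep_subset _ _)).linearIndependent
  induction hm : {b ∈ B | b ∉ Z ∧ b ∈ 𝓗 n}.ncard using Nat.strong_induction_on generalizing B with
  | _ m ih =>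
    by_cases hne : ∃ r ∈ B, r ∉ Z ∧ r ∈ 𝓗 n
    · obtain ⟨r, hr, hrZ, hrn⟩ := hne
      obtain ⟨h1, h2⟩ := h.eliminate hZ hr hrZ hrn
      have hfin2 := hfin.subset (h2.trans Set.sdiff_subset)
      refine ih _ ?_ h1 hfin2 rfl
      rw [← hm]
      refine Set.ncard_lt_ncard ⟨h2.trans Set.sdiff_subset, fun h3 => ?_⟩ hfin
      exact (h2 (h3 ⟨hr, hrZ, hrn⟩)).2 rfl
    · push Not at hne
      refine ⟨B, h.free, h.subset, fun b hb => ?_, h.le_lieSpan⟩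
      by_cases hbZ : b ∈ Z
      · exact Or.inl hbZ
      · obtain ⟨k, hk, hbk⟩ := (h.weight b hb).resolve_left hbZ
        refine Or.inr ⟨k, ?_, hbk⟩
        rcases hk.eq_or_lt with rfl | hlt
        · exact absurd hbk (hne b hb hbZ)
        · exact hlt

/-- A set is irredundant if none of its elements is in the Lie subalgebra generated by the
other ones. -/
def IsIrredundant (K : Type*) [Field K] {L : Type*} [LieRing L] [LieAlgebra K L] (Y : Set L) :
    Prop :=
  ∀ y ∈ Y, y ∉ LieSubalgebra.lieSpan K L (Y \ {y})

theorem IsIrredundant.linearIndependent {L : Type*} [LieRing L] [LieAlgebra K L] {Y : Set L}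
    (hY : IsIrredundant K Y) : LinearIndependent K ((↑) : Y → L) := by
  have : LinearIndepOn K id Y := by
    rw [linearIndepOn_iff_notMem_span]
    intro y hy hmem
    rw [Set.image_id] at hmem
    exact hY y hy (LieSubalgebra.submodule_span_le_lieSpan hmem)
  exact this

/-- An irredundant set of homogeneous elements of a free Lie algebra is free: this is the graded
case of the theorem of Shirshov and Witt. -/
theorem IsIrredundant.isFreeFamily [Finite X] {Y : Set 𝓛} (hY : IsIrredundant K Y)
    (hhom : ∀ y ∈ Y, ∃ k, y ∈ 𝓗 k) : IsFreeFamily K ((↑) : Y → 𝓛) := by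
  -- the elements of `Y` of weight less than `n` are part of a free set `B`
  let Z : ℕ → Set 𝓛 := fun n => {y ∈ Y | ∃ k, k < n ∧ y ∈ 𝓗 k}
  have hZhom : ∀ n, ∀ y ∈ Z n, ∃ k, y ∈ 𝓗 k := fun n y hy => hhom y hy.1
  have key : ∀ n, ∃ B, IsAdapted (Z n) B n n := by
    intro n
    induction n with
    | zero =>
      have hfree : IsFreeFamily K (FreeLieAlgebra.of K : X → 𝓛) := by
        have : FreeLieAlgebra.lift K (FreeLieAlgebra.of K : X → 𝓛) = LieHom.id := by
          ext x
          simp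
        unfold IsFreeFamily
        rw [this]
        exact fun _ _ h => h
      refine ⟨Set.range (FreeLieAlgebra.of K), hfree.range, ?_, ?_, ?_⟩
      · rintro y ⟨-, k, hk, -⟩
        omega
      · rintro _ ⟨x, rfl⟩
        exact Or.inr ⟨1, by omega, of_mem_homogeneousComponent x⟩
      · intro k _ x _
        rw [lieSpan_range_of]
        exact LieSubalgebra.mem_top x
    | succ n ih =>
      have hfin : {y ∈ Y | y ∈ 𝓗 n}.Finite := by
        refine finite_of_linearIndependent (n := n) (fun x hx => hx.2) ?_
        exact hY.linearIndependent.comp (Set.inclusion (Set.sep_subset _ _))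
          (Set.inclusion_injective _)
      have hins : ∀ T ⊆ {y ∈ Y | y ∈ 𝓗 n}, T.Finite → ∃ B, IsAdapted (T ∪ Z n) B n n := by
        intro T hT hTfin
        induction T, hTfin using Set.Finite.induction_on with
        | empty => simpa using ih
        | @insert c T hc _ ihT =>
          obtain ⟨B, hB⟩ := ihT ((Set.subset_insert _ _).trans hT)
          obtain ⟨hcY, hcn⟩ := hT (Set.mem_insert _ _)
          have hTZ : T ∪ Z n ⊆ Y \ {c} := by
            rintro y (hy | hy)
            · exact ⟨(hT (Set.mem_insert_of_mem _ hy)).1, fun h => hc (h ▸ hy)⟩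
            · refine ⟨hy.1, fun h => ?_⟩
              obtain ⟨k, hk, hyk⟩ := hy.2
              rw [Set.mem_singleton_iff] at h
              subst h
              have h0 : y ≠ 0 := hY.linearIndependent.ne_zero ⟨y, hcY⟩
              have := eq_of_mem_homogeneousComponent hyk hcn h0
              omega
          rw [Set.insert_union]
          exact hB.exists_insert (fun b hb => hhom b (hTZ hb).1) hcn
            fun h => hY c hcY (LieSubalgebra.lieSpan_mono hTZ h)
      obtain ⟨B, hB⟩ := hins _ subset_rfl hfin
      have hZs : {y ∈ Y | y ∈ 𝓗 n} ∪ Z n = Z (n + 1) := by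
        ext y
        constructor
        · rintro (⟨hy, hyn⟩ | ⟨hy, k, hk, hyk⟩)
          · exact ⟨hy, n, by omega, hyn⟩
          · exact ⟨hy, k, by omega, hyk⟩
        · rintro ⟨hy, k, hk, hyk⟩
          rcases (Nat.lt_succ_iff.1 hk).eq_or_lt with rfl | hlt
          · exact Or.inl ⟨hy, hyk⟩
          · exact Or.inr ⟨hy, k, hlt, hyk⟩
      rw [hZs] at hB
      have hB' : IsAdapted (Z (n + 1)) B n (n + 1) :=
        ⟨hB.free, hB.subset, hB.weight, fun k hk => hB.le_lieSpan k (by omega)⟩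
      exact hB'.exists_succ (hZhom _)
  have hmono : Monotone Z := fun m n hmn y ⟨hy, k, hk, hyk⟩ => ⟨hy, k, by omega, hyk⟩
  have hU : Y = ⋃ n, Z n := by
    ext y
    rw [Set.mem_iUnion]
    constructor
    · intro hy
      obtain ⟨k, hk⟩ := hhom y hy
      exact ⟨k + 1, hy, k, by omega, hk⟩
    · rintro ⟨n, hy, -⟩
      exact hy
  rw [hU]
  refine isFreeFamily_iUnion hmono fun n => ?_
  obtain ⟨B, hB⟩ := key n
  exact hB.free.mono hB.subset

end Irredundant

/-! ### Basic commutators span the free Lie algebra -/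

section Basic

variable {K : Type*} [Field K] {X : Type*} {r : FreeMagma X → FreeMagma X → Prop}

theorem IsBasic.mul_inv {y z : FreeMagma X} (h : IsBasic r (y * z)) :
    IsBasic r y ∧ IsBasic r z ∧ r z y := by
  generalize hw : y * z = w at h
  cases h with
  | of x => exact absurd hw (by rintro ⟨⟩)
  | mul u v hu hv huv _ =>
    obtain ⟨rfl, rfl⟩ : y = u ∧ z = v := by
      injection hw with h1 h2
      exact ⟨h1, h2⟩
    exact ⟨hu, hv, huv⟩

theorem IsBasicOrder.trichotomy (hr : IsBasicOrder r) {u v : FreeMagma X} (hu : IsBasic r u)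
    (hv : IsBasic r v) : r u v ∨ u = v ∨ r v u := by
  have := hr.wellOrder
  rcases trichotomous_of (fun u v : {w : FreeMagma X // IsBasic r w} => r u.1 v.1)
    ⟨u, hu⟩ ⟨v, hv⟩ with h | h | h
  · exact Or.inl h
  · exact Or.inr (Or.inl (congrArg Subtype.val h))
  · exact Or.inr (Or.inr h)

theorem IsBasicOrder.trans (hr : IsBasicOrder r) {u v w : FreeMagma X} (hu : IsBasic r u)
    (hv : IsBasic r v) (hw : IsBasic r w) (huv : r u v) (hvw : r v w) : r u w := by
  have := hr.wellOrder
  exact trans_of (fun u v : {w : FreeMagma X // IsBasic r w} => r u.1 v.1)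
    (a := ⟨u, hu⟩) (b := ⟨v, hv⟩) (c := ⟨w, hw⟩) huv hvw

theorem IsBasicOrder.irrefl (hr : IsBasicOrder r) {u : FreeMagma X} (hu : IsBasic r u) :
    ¬ r u u := by
  have := hr.wellOrder
  exact irrefl_of (fun u v : {w : FreeMagma X // IsBasic r w} => r u.1 v.1) ⟨u, hu⟩

/-- The span of the basic commutators `[a, b]` of weight `n` with `b ≥ v`. -/
def basicSpanGE (K : Type*) [Field K] {X : Type*} (r : FreeMagma X → FreeMagma X → Prop) (n : ℕ)
    (v : FreeMagma X) : Submodule K (FreeLieAlgebra K X) :=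
  Submodule.span K (commutatorValue K ''
    {w | IsBasic r w ∧ w.length = n ∧ ∃ a b, w = a * b ∧ (b = v ∨ r v b)})

theorem commutatorValue_mul (u v : FreeMagma X) :
    commutatorValue K (u * v) = ⁅commutatorValue K u, commutatorValue K v⁆ := rfl

theorem basicSpanGE_mono (hr : IsBasicOrder r) {n : ℕ} {v v' : FreeMagma X} (hv : IsBasic r v)
    (hv' : IsBasic r v') (h : r v v') : basicSpanGE K r n v' ≤ basicSpanGE K r n v := by
  refine Submodule.span_mono (Set.image_mono ?_)
  rintro _ ⟨hw, hn, a, b, rfl, hb⟩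
  refine ⟨hw, hn, a, b, rfl, Or.inr ?_⟩
  rcases hb with rfl | hb
  · exact h
  · exact hr.trans hv hv' hw.mul_inv.2.1 h hb

/-- The collecting process: a bracket `[u, v]` of basic commutators with `u > v` is a linear
combination of basic commutators `[a, b]` with `b ≥ v`. When `u = [y, z]` with `z > v`, the Jacobi
identity expresses it by brackets of basic commutators that are all greater than `v`, and there are
only finitely many candidates for `v`. -/
theorem lie_mem_basicSpanGE [Finite X] (hr : IsBasicOrder r) {n : ℕ} {u v : FreeMagma X}
    (hu : IsBasic r u) (hv : IsBasic r v) (huv : r v u) (hn : u.length + v.length = n) :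
    ⁅commutatorValue K u, commutatorValue K v⁆ ∈ basicSpanGE K r n v := by
  induction n using Nat.strong_induction_on generalizing u v with
  | _ n ihn =>
  have hfin : ∀ v, {b | IsBasic r b ∧ b.length < n ∧ r v b}.Finite := by
    intro v
    exact (finite_setOf_length_lt n).subset fun b hb => hb.2.1
  induction hm : {b | IsBasic r b ∧ b.length < n ∧ r v b}.ncard using Nat.strong_induction_on
    generalizing u v with
  | _ m ihm =>
  have key : ∀ a b, IsBasic r a → IsBasic r b → r v a → r v b → a.length + b.length = n →
      ⁅commutatorValue K a, commutatorValue K b⁆ ∈ basicSpanGE K r n v := by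
    have main : ∀ a b, IsBasic r a → IsBasic r b → r v b → r b a → a.length + b.length = n →
        ⁅commutatorValue K a, commutatorValue K b⁆ ∈ basicSpanGE K r n v := by
      intro a b ha hb hvb hba hab
      refine basicSpanGE_mono hr hv hb hvb (ihm _ ?_ ha hb hba hab rfl)
      rw [← hm]
      refine Set.ncard_lt_ncard ⟨?_, fun h => ?_⟩ (hfin v)
      · rintro c ⟨hc, hcn, hbc⟩
        exact ⟨hc, hcn, hr.trans hv hb hc hvb hbc⟩
      · have := FreeMagma.length_pos a
        exact hr.irrefl hb (h ⟨hb, by omega, hvb⟩).2.2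
    intro a b ha hb hva hvb hab
    rcases hr.trichotomy ha hb with h | rfl | h
    · rw [← lie_skew]
      exact neg_mem (main b a hb ha hva h (by omega))
    · simp
    · exact main a b ha hb hvb h hab
  have hbasic : ∀ (_ : ∀ y z : FreeMagma X, u = y * z → r z v ∨ z = v),
      ⁅commutatorValue K u, commutatorValue K v⁆ ∈ basicSpanGE K r n v := fun h =>
    Submodule.subset_span ⟨u * v, ⟨IsBasic.mul u v hu hv huv h, hn, u, v, rfl, Or.inl rfl⟩, rfl⟩
  by_cases hcase : ∀ y z : FreeMagma X, u = y * z → r z v ∨ z = v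
  · exact hbasic hcase
  push Not at hcase
  obtain ⟨y, z, rfl, hzv, hne⟩ := hcase
  obtain ⟨hy, hz, hzy⟩ := hu.mul_inv
  have hvz : r v z := by
    rcases hr.trichotomy hv hz with h | h | h
    · exact h
    · exact absurd h.symm hne
    · exact absurd h hzv
  have hvy : r v y := hr.trans hv hz hy hvz hzy
  have hlen : y.length + z.length + v.length = n := hn
  have hly := FreeMagma.length_pos y
  have hlz := FreeMagma.length_pos z
  have hlv := FreeMagma.length_pos v
  have h1 := ihn (y.length + v.length) (by omega) hy hv hvy rfl
  have h2 := ihn (z.length + v.length) (by omega) hz hv hvz rfl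
  have h1' : ∀ x ∈ basicSpanGE K r (y.length + v.length) v,
      ⁅x, commutatorValue K z⁆ ∈ basicSpanGE K r n v := by
    intro x hx
    induction hx using Submodule.span_induction with
    | mem x hx =>
      obtain ⟨w, ⟨hw, hwn, -⟩, rfl⟩ := hx
      exact key w z hw hz (hr.weight_lt v w hv hw (by omega)) hvz (by omega)
    | zero => simp
    | add x y _ _ hx hy => rw [add_lie]; exact add_mem hx hy
    | smul c x _ hx => rw [smul_lie]; exact Submodule.smul_mem _ c hx
  have h2' : ∀ x ∈ basicSpanGE K r (z.length + v.length) v,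
      ⁅commutatorValue K y, x⁆ ∈ basicSpanGE K r n v := by
    intro x hx
    induction hx using Submodule.span_induction with
    | mem x hx =>
      obtain ⟨w, ⟨hw, hwn, -⟩, rfl⟩ := hx
      exact key y w hy hw hvy (hr.weight_lt v w hv hw (by omega)) (by omega)
    | zero => simp
    | add x y _ _ hx hy => rw [lie_add]; exact add_mem hx hy
    | smul c x _ hx => rw [lie_smul]; exact Submodule.smul_mem _ c hx
  have hjac : ⁅commutatorValue K (y * z), commutatorValue K v⁆ =
      ⁅⁅commutatorValue K y, commutatorValue K v⁆, commutatorValue K z⁆ +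
        ⁅commutatorValue K y, ⁅commutatorValue K z, commutatorValue K v⁆⁆ := by
    rw [commutatorValue_mul, lie_lie, ← lie_skew _ (commutatorValue K z)]
    abel
  rw [hjac]
  exact add_mem (h1' _ h1) (h2' _ h2)

theorem homogeneousComponent_le_span_isBasic [Finite X] (hr : IsBasicOrder r) (n : ℕ) :
    homogeneousComponent K X n ≤
      Submodule.span K (commutatorValue K '' {w | IsBasic r w ∧ w.length = n}) := by
  set S : ℕ → Submodule K (FreeLieAlgebra K X) := fun n =>
    Submodule.span K (commutatorValue K '' {w | IsBasic r w ∧ w.length = n})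
  have hge : ∀ n v, basicSpanGE K r n v ≤ S n := fun n v =>
    Submodule.span_mono (Set.image_mono fun w hw => ⟨hw.1, hw.2.1⟩)
  have hS : ∀ m n, ∀ x ∈ S m, ∀ y ∈ S n, ⁅x, y⁆ ∈ S (m + n) := by
    intro m n x hx y hy
    induction hx, hy using Submodule.span_induction₂ with
    | mem_mem x y hx hy =>
      obtain ⟨u, ⟨hu, rfl⟩, rfl⟩ := hx
      obtain ⟨v, ⟨hv, rfl⟩, rfl⟩ := hy
      rcases hr.trichotomy hu hv with h | rfl | h
      · rw [← lie_skew]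
        exact neg_mem (hge _ u (lie_mem_basicSpanGE hr hv hu h (add_comm _ _)))
      · simp
      · exact hge _ v (lie_mem_basicSpanGE hr hu hv h rfl)
    | zero_left => simp
    | zero_right => simp
    | add_left _ _ _ _ _ _ h1 h2 => rw [add_lie]; exact add_mem h1 h2
    | add_right _ _ _ _ _ _ h1 h2 => rw [lie_add]; exact add_mem h1 h2
    | smul_left c _ _ _ _ h => rw [smul_lie]; exact Submodule.smul_mem _ _ h
    | smul_right c _ _ _ _ h => rw [lie_smul]; exact Submodule.smul_mem _ _ h
  refine Submodule.span_le.2 ?_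
  rintro _ ⟨w, rfl, rfl⟩
  induction w with
  | ih1 x => exact Submodule.subset_span ⟨FreeMagma.of x, ⟨IsBasic.of x, rfl⟩, rfl⟩
  | ih2 u v hu hv => exact hS _ _ _ hu _ hv

/-- Admissible orders exist: compare the weights first, and then use any well-order. -/
theorem exists_isBasicOrder (X : Type*) : ∃ r : FreeMagma X → FreeMagma X → Prop,
    IsBasicOrder r := by
  let R : ℕ × FreeMagma X → ℕ × FreeMagma X → Prop := Prod.Lex (· < ·) WellOrderingRel
  let f : FreeMagma X ↪ ℕ × FreeMagma X :=
    ⟨fun w => (w.length, w), fun u v h => (Prod.ext_iff.1 h).2⟩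
  let r : FreeMagma X → FreeMagma X → Prop := fun u v => R (f u) (f v)
  refine ⟨r, ?_, fun u v _ _ h => Prod.Lex.left _ _ h⟩
  have hwo : IsWellOrder _ R := inferInstance
  let g : {w : FreeMagma X // IsBasic r w} ↪ ℕ × FreeMagma X :=
    (Function.Embedding.subtype _).trans f
  exact (RelEmbedding.preimage g R).isWellOrder

end Basic

/-! ### Greedy choice of basic commutators -/

section Greedy

variable {K : Type*} [Field K] {X : Type*}

local notation "𝓛" => FreeLieAlgebra K X
local notation "𝓗" => homogeneousComponent K X

/-- Generators of weight greater than `n` contribute nothing in weight `n`. -/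
theorem mem_lieSpan_of_weight_lt {B Z : Set 𝓛} {n : ℕ} (hZ : ∀ b ∈ Z, ∃ k, b ∈ 𝓗 k)
    (hB : ∀ b ∈ B, b ∈ Z ∨ ∃ k, n < k ∧ b ∈ 𝓗 k) {x : 𝓛}
    (hx : x ∈ LieSubalgebra.lieSpan K 𝓛 B) (hxn : x ∈ 𝓗 n) :
    x ∈ LieSubalgebra.lieSpan K 𝓛 Z := by
  have h := mem_span_sup_lieSpan hZ
    (fun b hb => (hB b hb).imp_right fun ⟨k, hk, hbk⟩ => ⟨k, hk.le, hbk⟩) hx hxn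
  have h0 : Submodule.span K {b ∈ B | b ∉ Z ∧ b ∈ 𝓗 n} = ⊥ := by
    rw [Submodule.span_eq_bot]
    rintro b ⟨hb, hbZ, hbn⟩
    by_contra hb0
    obtain ⟨k, hk, hbk⟩ := (hB b hb).resolve_left hbZ
    have := eq_of_mem_homogeneousComponent hbk hbn hb0
    omega
  rwa [h0, bot_sup_eq] at h

theorem mem_span_singleton_sup_of_insert {Z : Set 𝓛} {n k : ℕ} (hkn : k ≤ n)
    (hZ : ∀ b ∈ Z, ∃ k, b ∈ 𝓗 k) {c : 𝓛} (hc : c ∈ 𝓗 n) {x : 𝓛}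
    (hx : x ∈ LieSubalgebra.lieSpan K 𝓛 (insert c Z)) (hxk : x ∈ 𝓗 k) :
    x ∈ Submodule.span K {c} ⊔ (LieSubalgebra.lieSpan K 𝓛 Z).toSubmodule := by
  have h := mem_span_sup_lieSpan (n := k) (Z := Z) hZ (by
    rintro b (rfl | hb)
    · exact Or.inr ⟨n, hkn, hc⟩
    · exact Or.inl hb) hx hxk
  have hle : Submodule.span K {b ∈ insert c Z | b ∉ Z ∧ b ∈ 𝓗 k} ≤ Submodule.span K {c} := by
    refine Submodule.span_mono ?_
    rintro b ⟨rfl | hb, hbZ, -⟩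
    · rfl
    · exact absurd hb hbZ
  have hle2 := sup_le_sup_right hle (LieSubalgebra.lieSpan K 𝓛 Z).toSubmodule
  exact hle2 h

/-- Irredundance is preserved by adding a new element of maximal weight. -/
theorem IsIrredundant.insert_of_weight_le {Z : Set 𝓛} {n : ℕ} (hirr : IsIrredundant K Z)
    (hZ : ∀ b ∈ Z, ∃ k, k ≤ n ∧ b ∈ 𝓗 k) {c : 𝓛} (hc : c ∈ 𝓗 n)
    (hcZ : c ∉ LieSubalgebra.lieSpan K 𝓛 Z) : IsIrredundant K (insert c Z) := by
  rintro y (rfl | hy) hmem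
  · refine hcZ (LieSubalgebra.lieSpan_mono ?_ hmem)
    rintro z ⟨hz | hz, hne⟩
    · exact absurd hz hne
    · exact hz
  · obtain ⟨k, hkn, hyk⟩ := hZ y hy
    have hsub : insert c Z \ {y} ⊆ insert c (Z \ {y}) := by
      rintro z ⟨rfl | hz, hne⟩
      · exact Set.mem_insert _ _
      · exact Set.mem_insert_of_mem _ ⟨hz, hne⟩
    obtain ⟨a, ha, v, hv, hav⟩ := Submodule.mem_sup.1 (mem_span_singleton_sup_of_insert hkn
      (fun b hb => (hZ b hb.1).imp fun _ h => h.2) hc (LieSubalgebra.lieSpan_mono hsub hmem) hyk)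
    obtain ⟨l, rfl⟩ := Submodule.mem_span_singleton.1 ha
    by_cases hl : l = 0
    · rw [hl, zero_smul, zero_add] at hav
      exact hirr y hy (hav ▸ hv)
    · have hv' : v ∈ LieSubalgebra.lieSpan K 𝓛 Z := LieSubalgebra.lieSpan_mono Set.sdiff_subset hv
      have h1 : y - v ∈ LieSubalgebra.lieSpan K 𝓛 Z :=
        sub_mem (LieSubalgebra.subset_lieSpan hy) hv'
      rw [← hav, add_sub_cancel_right] at h1
      have h2 := LieSubalgebra.smul_mem _ l⁻¹ h1
      rw [smul_smul, inv_mul_cancel₀ hl, one_smul] at h2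
      exact hcZ h2

/-- The dimension of the component of weight `n` of the subalgebra generated by `Z`. -/
def componentRank (Z : Set (FreeLieAlgebra K X)) (n : ℕ) : ℕ :=
  Module.finrank K ((LieSubalgebra.lieSpan K (FreeLieAlgebra K X) Z).toSubmodule ⊓
    homogeneousComponent K X n : Submodule K (FreeLieAlgebra K X))

theorem componentRank_le [Finite X] (Z : Set 𝓛) (n : ℕ) :
    componentRank Z n ≤ Module.finrank K (𝓗 n) :=
  Submodule.finrank_mono inf_le_right

/-- A new generator of weight `n` raises the dimension in weight `n` by one. -/
theorem componentRank_insert [Finite X] {Z : Set 𝓛} {n : ℕ} (hZ : ∀ b ∈ Z, ∃ k, b ∈ 𝓗 k) {c : 𝓛}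
    (hc : c ∈ 𝓗 n) (hcZ : c ∉ LieSubalgebra.lieSpan K 𝓛 Z) :
    componentRank (insert c Z) n = componentRank Z n + 1 := by
  have hc0 : c ≠ 0 := fun h => hcZ (h ▸ zero_mem _)
  have h1 : ((LieSubalgebra.lieSpan K 𝓛 (insert c Z)).toSubmodule ⊓ 𝓗 n : Submodule K 𝓛) =
      ((LieSubalgebra.lieSpan K 𝓛 Z).toSubmodule ⊓ 𝓗 n) ⊔ Submodule.span K {c} := by
    apply le_antisymm
    · rintro x ⟨hx, hxn⟩
      obtain ⟨a, ha, v, hv, rfl⟩ :=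
        Submodule.mem_sup.1 (mem_span_singleton_sup_of_insert le_rfl hZ hc hx hxn)
      have ha' : a ∈ 𝓗 n := by
        obtain ⟨l, rfl⟩ := Submodule.mem_span_singleton.1 ha
        exact Submodule.smul_mem _ l hc
      rw [add_comm a v]
      refine Submodule.add_mem_sup ⟨hv, ?_⟩ ha
      simpa using sub_mem hxn ha'
    · refine sup_le (inf_le_inf_right _ (LieSubalgebra.lieSpan_mono (Set.subset_insert _ _))) ?_
      rw [Submodule.span_singleton_le_iff_mem]
      exact ⟨LieSubalgebra.subset_lieSpan (Set.mem_insert _ _), hc⟩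
  have h2 : ((LieSubalgebra.lieSpan K 𝓛 Z).toSubmodule ⊓ 𝓗 n) ⊓ Submodule.span K {c} = ⊥ := by
    rw [eq_bot_iff]
    rintro x ⟨⟨hx, -⟩, hxc⟩
    obtain ⟨l, rfl⟩ := Submodule.mem_span_singleton.1 hxc
    by_cases hl : l = 0
    · simp [hl]
    · have h2 := LieSubalgebra.smul_mem _ l⁻¹ hx
      rw [smul_smul, inv_mul_cancel₀ hl, one_smul] at h2
      exact absurd h2 hcZ
  have h3 := Submodule.finrank_sup_add_finrank_inf_eq
    ((LieSubalgebra.lieSpan K 𝓛 Z).toSubmodule ⊓ 𝓗 n) (Submodule.span K {c})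
  rw [h2, finrank_bot, finrank_span_singleton hc0, ← h1] at h3
  exact h3

variable {r : FreeMagma X → FreeMagma X → Prop}

/-- `Z` is an irredundant set of basic commutators of weight less than `n`. -/
structure IsPartialChoice (r : FreeMagma X → FreeMagma X → Prop) (n : ℕ)
    (Z : Set (FreeLieAlgebra K X)) : Prop where
  irredundant : IsIrredundant K Z
  basic : Z ⊆ commutatorValue K '' {w | IsBasic r w ∧ w.length < n}

theorem IsPartialChoice.weight {n : ℕ} {Z : Set 𝓛} (h : IsPartialChoice r n Z) :
    ∀ b ∈ Z, ∃ k, k < n ∧ b ∈ 𝓗 k := by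
  intro b hb
  obtain ⟨w, ⟨-, hw⟩, rfl⟩ := h.basic hb
  exact ⟨_, hw, commutatorValue_mem w⟩

/-- Basic commutators of weight `n` can be added so as to raise the dimension in weight `n` by any
admissible number `k`, since they span the component. -/
theorem IsPartialChoice.exists_extension [Finite X] (hr : IsBasicOrder r) {n : ℕ} {Z : Set 𝓛}
    (h : IsPartialChoice r n Z) (k : ℕ) (hk : componentRank Z n + k ≤ Module.finrank K (𝓗 n)) :
    ∃ Z', IsPartialChoice r (n + 1) Z' ∧ Z ⊆ Z' ∧ (∀ b ∈ Z', b ∈ Z ∨ b ∈ 𝓗 n) ∧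
      componentRank Z' n = componentRank Z n + k ∧ (k = 0 → Z' = Z) := by
  induction k with
  | zero =>
    refine ⟨Z, ⟨h.irredundant, ?_⟩, subset_rfl, fun b hb => Or.inl hb, rfl, fun _ => rfl⟩
    exact h.basic.trans (Set.image_mono fun w hw => ⟨hw.1, by have := hw.2; omega⟩)
  | succ k ih =>
    obtain ⟨Z', hZ', hsub, hwt, hrank, -⟩ := ih (by omega)
    have hnle : ¬ 𝓗 n ≤ (LieSubalgebra.lieSpan K 𝓛 Z').toSubmodule := by
      intro hle
      have : componentRank Z' n = Module.finrank K (𝓗 n) := by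
        rw [componentRank, inf_eq_right.2 hle]
      omega
    have : ∃ w, IsBasic r w ∧ w.length = n ∧
        commutatorValue K w ∉ LieSubalgebra.lieSpan K 𝓛 Z' := by
      by_contra hno
      push Not at hno
      refine hnle ((homogeneousComponent_le_span_isBasic hr n).trans (Submodule.span_le.2 ?_))
      rintro _ ⟨w, ⟨hw, hwn⟩, rfl⟩
      exact hno w hw hwn
    obtain ⟨w, hw, rfl, hwZ⟩ := this
    have hweight := hZ'.weight
    have hwmem := commutatorValue_mem (K := K) w
    refine ⟨insert (commutatorValue K w) Z', ⟨?_, ?_⟩, hsub.trans (Set.subset_insert _ _), ?_, ?_,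
      fun h => by omega⟩
    · exact hZ'.irredundant.insert_of_weight_le
        (fun b hb => (hweight b hb).imp fun k hk => ⟨by omega, hk.2⟩) hwmem hwZ
    · rintro b (rfl | hb)
      · exact ⟨w, ⟨hw, by omega⟩, rfl⟩
      · exact hZ'.basic hb
    · rintro b (rfl | hb)
      · exact Or.inr hwmem
      · exact hwt b hb
    · rw [componentRank_insert (fun b hb => (hweight b hb).imp fun k hk => hk.2) hwmem hwZ, hrank]
      omega

/-- A growing sequence of irredundant sets of basic commutators, whose dimensions stay above a
prescribed bound `τ` and which only grows when this is necessary for staying above `τ`. -/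
theorem exists_greedy_sequence [Finite X] (K : Type*) [Field K] (hr : IsBasicOrder r) (τ : ℕ → ℕ)
    (hτ0 : τ 0 = 0)
    (hτ : ∀ n, τ (n + 1) ≤ τ n + Module.finrank K (homogeneousComponent K X (n + 1))) :
    ∃ Z : ℕ → Set (FreeLieAlgebra K X), Monotone Z ∧ Z 0 = ∅ ∧ (∀ n, IsPartialChoice r n (Z n)) ∧
      (∀ n, ∀ b ∈ Z (n + 1), b ∈ Z n ∨ b ∈ homogeneousComponent K X n) ∧
      (∀ n, τ n ≤ ∑ i ∈ range (n + 1), componentRank (⋃ m, Z m) i) ∧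
      (∀ n, Z (n + 1) = Z n ∨
        (0 < τ n ∧ ∑ i ∈ range (n + 1), componentRank (⋃ m, Z m) i ≤ τ n)) := by
  classical
  -- the number of elements to be added in weight `n`; it is `0` if nothing is needed
  let k : ℕ → Set (FreeLieAlgebra K X) → ℕ := fun n Z =>
    min (Module.finrank K (homogeneousComponent K X n)) (τ n - ∑ i ∈ range n, componentRank Z i) -
      componentRank Z n
  have hk : ∀ n Z, componentRank Z n + k n Z ≤
      Module.finrank K (homogeneousComponent K X n) := by
    intro n Z
    have := componentRank_le Z n
    simp only [k]
    omega
  have hstep : ∀ n (Z : {Z : Set (FreeLieAlgebra K X) // IsPartialChoice r n Z}),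
      ∃ Z' : {Z : Set (FreeLieAlgebra K X) // IsPartialChoice r (n + 1) Z}, Z.1 ⊆ Z'.1 ∧
        (∀ b ∈ Z'.1, b ∈ Z.1 ∨ b ∈ homogeneousComponent K X n) ∧
        componentRank Z'.1 n = componentRank Z.1 n + k n Z.1 ∧ (k n Z.1 = 0 → Z'.1 = Z.1) := by
    intro n Z
    obtain ⟨Z', h1, h2⟩ := Z.2.exists_extension hr (k n Z.1) (hk n Z.1)
    exact ⟨⟨Z', h1⟩, h2⟩
  choose F hF using hstep
  let G : ∀ n, {Z : Set (FreeLieAlgebra K X) // IsPartialChoice r n Z} := fun n =>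
    Nat.rec ⟨∅, ⟨fun y hy => hy.elim, fun y hy => hy.elim⟩⟩ (fun n Z => F n Z) n
  let Z : ℕ → Set (FreeLieAlgebra K X) := fun n => (G n).1
  have hZ : ∀ n, Z n ⊆ Z (n + 1) ∧ (∀ b ∈ Z (n + 1), b ∈ Z n ∨ b ∈ homogeneousComponent K X n) ∧
        componentRank (Z (n + 1)) n = componentRank (Z n) n + k n (Z n) ∧
        (k n (Z n) = 0 → Z (n + 1) = Z n) := fun n => hF n (G n)
  have hmono : Monotone Z := monotone_nat_of_le_succ fun n => (hZ n).1
  have hpart : ∀ n, IsPartialChoice r n (Z n) := fun n => (G n).2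
  have hlarge : ∀ n m, ∀ b ∈ Z (n + m), b ∈ Z n ∨ ∃ k, n ≤ k ∧ b ∈ homogeneousComponent K X k := by
    intro n m
    induction m with
    | zero => exact fun b hb => Or.inl hb
    | succ m ih =>
      intro b hb
      rcases (hZ (n + m)).2.1 b hb with h | h
      · exact ih b h
      · exact Or.inr ⟨n + m, by omega, h⟩
  -- the component of weight `i` does not change after step `i`
  have hrank : ∀ n i, i < n → componentRank (⋃ m, Z m) i = componentRank (Z n) i := by
    intro n i hi
    have : ((LieSubalgebra.lieSpan K (FreeLieAlgebra K X) (⋃ m, Z m)).toSubmodule ⊓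
        homogeneousComponent K X i : Submodule K (FreeLieAlgebra K X)) =
        (LieSubalgebra.lieSpan K (FreeLieAlgebra K X) (Z n)).toSubmodule ⊓
          homogeneousComponent K X i := by
      apply le_antisymm
      · rintro x ⟨hx, hxi⟩
        refine ⟨mem_lieSpan_of_weight_lt (fun b hb => ?_) (fun b hb => ?_) hx hxi, hxi⟩
        · obtain ⟨k, -, hk⟩ := (hpart n).weight b hb
          exact ⟨k, hk⟩
        · obtain ⟨m, hm⟩ := Set.mem_iUnion.1 hb
          have hm' : b ∈ Z (n + m) := hmono (by omega) hm
          exact (hlarge n m b hm').imp_right fun ⟨k, hk, hbk⟩ => ⟨k, by omega, hbk⟩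
      · exact inf_le_inf_right _ (LieSubalgebra.lieSpan_mono (Set.subset_iUnion Z n))
    rw [componentRank, this, componentRank]
  have hsum : ∀ n, ∑ i ∈ range n, componentRank (⋃ m, Z m) i =
      ∑ i ∈ range n, componentRank (Z n) i := fun n =>
    sum_congr rfl fun i hi => hrank n i (mem_range.1 hi)
  have hrec : ∀ n, componentRank (⋃ m, Z m) n = componentRank (Z n) n +
      (min (Module.finrank K (homogeneousComponent K X n))
        (τ n - ∑ i ∈ range n, componentRank (⋃ m, Z m) i) - componentRank (Z n) n) := by
    intro n
    rw [hrank (n + 1) n (by omega), (hZ n).2.2.1, hsum]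
  refine ⟨Z, hmono, rfl, hpart, fun n => (hZ n).2.1, ?_, ?_⟩
  · intro n
    induction n with
    | zero => omega
    | succ n ih =>
      have h1 := hrec (n + 1)
      have h2 := hτ n
      rw [sum_range_succ]
      omega
  · intro n
    by_cases h0 : k n (Z n) = 0
    · exact Or.inl ((hZ n).2.2.2 h0)
    · right
      have h1 := hrec n
      have h2 : k n (Z n) = min (Module.finrank K (homogeneousComponent K X n))
        (τ n - ∑ i ∈ range n, componentRank (⋃ m, Z m) i) - componentRank (Z n) n := by
        rw [hsum]
      rw [sum_range_succ]
      omega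

end Greedy

/-! ### A metabelian quotient -/

section Metabelian

open Polynomial

attribute [local instance] LieRing.ofAssociativeRing LieAlgebra.ofAssociativeAlgebra

variable {K : Type*} [Field K] {X : Type*}

local notation "𝓛" => FreeLieAlgebra K X
local notation "𝓗" => homogeneousComponent K X

/-- The homomorphism to the Lie algebra of `2 × 2` matrices over `K[t]` that sends `x₀` to the
matrix `t E₁₁`, sends `x₁` to `E₁₂` and kills the other generators. -/
def metabelianHom (K : Type*) [Field K] {X : Type*} [DecidableEq X] (x₀ x₁ : X) :
    FreeLieAlgebra K X →ₗ⁅K⁆ Matrix (Fin 2) (Fin 2) K[X] :=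
  FreeLieAlgebra.lift K fun x =>
    if x = x₀ then Matrix.single 0 0 Polynomial.X else if x = x₁ then Matrix.single 0 1 1 else 0

variable [DecidableEq X] {x₀ x₁ : X}

theorem metabelianHom_of_left : metabelianHom K x₀ x₁ (FreeLieAlgebra.of K x₀) =
    Matrix.single 0 0 Polynomial.X := by
  simp [metabelianHom]

theorem metabelianHom_iteratedLie (h : x₀ ≠ x₁) (s : List Unit) :
    metabelianHom K x₀ x₁ (iteratedLie (fun _ => FreeLieAlgebra.of K x₀) s
      (FreeLieAlgebra.of K x₁)) = Matrix.single 0 1 (Polynomial.X ^ s.length) := by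
  induction s with
  | nil => simp [metabelianHom, h.symm]
  | cons a s ih =>
    rw [iteratedLie_cons, LieHom.map_lie, ih, metabelianHom_of_left,
      LieRing.of_associative_ring_bracket]
    simp [pow_succ']

theorem metabelianHom_row_one (x : 𝓛) (j : Fin 2) : metabelianHom K x₀ x₁ x 1 j = 0 := by
  induction x using freeLieAlgebra_induction generalizing j with
  | hof i =>
    simp only [metabelianHom, FreeLieAlgebra.lift_of_apply]
    split_ifs <;> simp
  | hadd a b ha hb => simp [ha, hb]
  | hsmul c a ha => simp [ha]
  | h0 => simp
  | hlie a b ha hb =>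
    rw [LieHom.map_lie, LieRing.of_associative_ring_bracket]
    simp [Matrix.mul_apply, ha, hb]

theorem metabelianHom_zero_zero {k : ℕ} (hk : 2 ≤ k) {x : 𝓛} (hx : x ∈ 𝓗 k) :
    metabelianHom K x₀ x₁ x 0 0 = 0 := by
  induction hx using Submodule.span_induction with
  | mem x hx =>
    obtain ⟨w, rfl, rfl⟩ := hx
    cases w with
    | of x => exact absurd hk (by simp [FreeMagma.length])
    | mul u v =>
      change metabelianHom K x₀ x₁ ⁅commutatorValue K u, commutatorValue K v⁆ 0 0 = 0
      rw [LieHom.map_lie, LieRing.of_associative_ring_bracket]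
      simp [Matrix.mul_apply, metabelianHom_row_one, mul_comm]
  | zero => simp
  | add x y _ _ hx hy => simp [hx, hy]
  | smul c x _ hx => simp [hx]

/-- A Lie subalgebra generated by finitely many homogeneous elements of weight at least `2` misses
some of the elements `[x₀, [x₀, … [x₀, x₁]]]` of arbitrarily large weight, since its image in the
metabelian quotient is finite dimensional. -/
theorem exists_iteratedLie_notMem (h : x₀ ≠ x₁) {Y : Set 𝓛} (hfin : Y.Finite)
    (hY : ∀ y ∈ Y, ∃ k, 2 ≤ k ∧ y ∈ 𝓗 k) (N : ℕ) :
    ∃ s : List Unit, N ≤ s.length ∧ iteratedLie (fun _ => FreeLieAlgebra.of K x₀) s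
      (FreeLieAlgebra.of K x₁) ∉ LieSubalgebra.lieSpan K 𝓛 Y := by
  set φ := metabelianHom K x₀ x₁
  have hbound : ∃ D : ℕ, ∀ y ∈ Y, φ y 0 1 ∈ degreeLT K D := by
    refine ⟨hfin.toFinset.sup (fun y => (φ y 0 1).natDegree) + 1, fun y hy => ?_⟩
    rw [mem_degreeLT]
    refine (degree_le_natDegree).trans_lt ?_
    have : (φ y 0 1).natDegree ≤ hfin.toFinset.sup (fun y => (φ y 0 1).natDegree) :=
      Finset.le_sup (f := fun y => (φ y 0 1).natDegree) (hfin.mem_toFinset.2 hy)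
    exact_mod_cast Nat.lt_succ_of_le this
  obtain ⟨D, hD⟩ := hbound
  have hspan : ∀ x ∈ LieSubalgebra.lieSpan K 𝓛 Y, φ x 0 0 = 0 ∧ φ x 0 1 ∈ degreeLT K D := by
    intro x hx
    induction hx using LieSubalgebra.lieSpan_induction with
    | mem x hx =>
      obtain ⟨k, hk, hxk⟩ := hY x hx
      exact ⟨metabelianHom_zero_zero hk hxk, hD x hx⟩
    | zero => simp
    | add x y _ _ hx hy =>
      refine ⟨by simp [hx.1, hy.1], ?_⟩
      rw [map_add, Matrix.add_apply]
      exact add_mem hx.2 hy.2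
    | smul c x _ hx =>
      refine ⟨by simp [hx.1], ?_⟩
      rw [map_smul, Matrix.smul_apply]
      exact Submodule.smul_mem _ c hx.2
    | lie x y _ _ hx hy =>
      have h1 : ∀ j, φ x 1 j = 0 := metabelianHom_row_one x
      have h2 : ∀ j, φ y 1 j = 0 := metabelianHom_row_one y
      rw [LieHom.map_lie, LieRing.of_associative_ring_bracket]
      simp [Matrix.mul_apply, hx.1, hy.1, h1, h2]
  refine ⟨List.replicate (max N D) (), by simp, fun hmem => ?_⟩
  have h1 := (hspan _ hmem).2
  simp only [φ] at h1
  rw [metabelianHom_iteratedLie h, Matrix.single_apply_same, mem_degreeLT, degree_X_pow,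
    List.length_replicate, Nat.cast_lt] at h1
  omega

theorem one_le_finrank_homogeneousComponent [Finite X] (h : x₀ ≠ x₁) {n : ℕ} (hn : n ≠ 0) :
    1 ≤ Module.finrank K (𝓗 n) := by
  set x := iteratedLie (fun _ => FreeLieAlgebra.of K x₀) (List.replicate (n - 1) ())
    (FreeLieAlgebra.of K x₁) with hx
  have hxn : x ∈ 𝓗 n := by
    have := iteratedLie_mem (of_mem_homogeneousComponent (K := K) x₀)
      (of_mem_homogeneousComponent (K := K) x₁) (List.replicate (n - 1) ())
    rw [List.length_replicate, mul_one, Nat.sub_add_cancel (by omega)] at this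
    exact this
  have hx0 : x ≠ 0 := by
    intro h0
    have h1 := metabelianHom_iteratedLie (K := K) h (List.replicate (n - 1) ())
    rw [← hx, h0, map_zero] at h1
    have h2 := congrFun (congrFun h1 0) 1
    simp only [Matrix.zero_apply, Matrix.single_apply_same] at h2
    exact pow_ne_zero _ Polynomial.X_ne_zero h2.symm
  have : Nontrivial (𝓗 n) := ⟨⟨x, hxn⟩, 0, fun h => hx0 (congrArg Subtype.val h)⟩
  exact Module.finrank_pos

theorem le_sum_finrank_homogeneousComponent [Finite X] (h : x₀ ≠ x₁) (n : ℕ) :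
    n ≤ ∑ i ∈ range (n + 1), Module.finrank K (𝓗 i) := by
  induction n with
  | zero => omega
  | succ n ih =>
    rw [sum_range_succ]
    have := one_le_finrank_homogeneousComponent (K := K) h (n := n + 1) (by omega)
    omega

end Metabelian

/-! ### Growth of finitely generated subalgebras -/

section Growth

variable {K : Type*} [Field K] {X : Type*}

local notation "𝓛" => FreeLieAlgebra K X
local notation "𝓗" => homogeneousComponent K X

/-- The Lie subalgebra generated by a family is spanned by the left-normed commutators. -/
theorem lieSpan_le_span_iteratedLie {L : Type*} [LieRing L] [LieAlgebra K L] {ι : Type*}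
    (g : ι → L) : (LieSubalgebra.lieSpan K L (Set.range g)).toSubmodule ≤
      Submodule.span K (Set.range fun q : List ι × ι => iteratedLie g q.1 (g q.2)) := by
  set V := Submodule.span K (Set.range fun q : List ι × ι => iteratedLie g q.1 (g q.2))
  have hstab : ∀ x ∈ LieSubalgebra.lieSpan K L (Set.range g), ∀ v ∈ V, ⁅x, v⁆ ∈ V := by
    intro x hx
    induction hx using LieSubalgebra.lieSpan_induction with
    | mem x hx =>
      obtain ⟨i, rfl⟩ := hx
      intro v hv
      induction hv using Submodule.span_induction with
      | mem v hv =>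
        obtain ⟨⟨s, j⟩, rfl⟩ := hv
        exact Submodule.subset_span ⟨(i :: s, j), rfl⟩
      | zero => simp
      | add x y _ _ hx hy => rw [lie_add]; exact add_mem hx hy
      | smul c x _ hx => rw [lie_smul]; exact Submodule.smul_mem _ c hx
    | zero => simp
    | add x y _ _ hx hy => intro v hv; rw [add_lie]; exact add_mem (hx v hv) (hy v hv)
    | smul c x _ hx => intro v hv; rw [smul_lie]; exact Submodule.smul_mem _ c (hx v hv)
    | lie x y _ _ hx hy =>
      intro v hv
      rw [lie_lie]
      exact sub_mem (hx _ (hy v hv)) (hy _ (hx v hv))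
  intro x hx
  induction hx using LieSubalgebra.lieSpan_induction with
  | mem x hx =>
    obtain ⟨i, rfl⟩ := hx
    exact Submodule.subset_span ⟨([], i), rfl⟩
  | zero => exact zero_mem _
  | add x y _ _ hx hy => exact add_mem hx hy
  | smul c x _ hx => exact Submodule.smul_mem _ c hx
  | lie x y hxM _ _ hy => exact hstab x hxM y hy

/-- The weight of a word, for given weights of its letters. -/
def wordWeight {ι : Type*} (wt : ι → ℕ) (s : List ι) : ℕ := (s.map wt).sum

theorem wordWeight_append {ι : Type*} (wt : ι → ℕ) (s t : List ι) :
    wordWeight wt (s ++ t) = wordWeight wt s + wordWeight wt t := by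
  simp [wordWeight]

theorem length_le_wordWeight {ι : Type*} {wt : ι → ℕ} (hwt : ∀ i, 1 ≤ wt i) (s : List ι) :
    s.length ≤ wordWeight wt s := by
  induction s with
  | nil => simp
  | cons a s ih =>
    have := hwt a
    simp only [wordWeight, List.map_cons, List.sum_cons, List.length_cons] at ih ⊢
    omega

theorem iteratedLie_mem_of_wordWeight {ι : Type*} {wt : ι → ℕ} {g : ι → 𝓛}
    (hg : ∀ i, g i ∈ 𝓗 (wt i)) (s : List ι) {x : 𝓛} {k : ℕ} (hx : x ∈ 𝓗 k) :
    iteratedLie g s x ∈ 𝓗 (wordWeight wt s + k) := by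
  induction s with
  | nil => simpa [wordWeight] using hx
  | cons a s ih =>
    have h := lie_mem_homogeneousComponent (hg a) ih
    rw [iteratedLie_cons]
    convert h using 2
    simp only [wordWeight, List.map_cons, List.sum_cons]
    omega

section Words

variable {ι : Type*}

/-- The words of weight at most `n`. -/
def wordsLE (wt : ι → ℕ) (n : ℕ) : Set (List ι) := {s | wordWeight wt s ≤ n}

theorem wordsLE_subset {wt : ι → ℕ} (hwt : ∀ i, 1 ≤ wt i) (n : ℕ) :
    wordsLE wt n ⊆ {s | s.length ≤ n} :=
  fun s hs => (length_le_wordWeight hwt s).trans hs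

variable [Finite ι]

theorem finite_setOf_length_le (n : ℕ) : {s : List ι | s.length ≤ n}.Finite :=
  List.finite_length_le ι n

theorem ncard_length_le (n : ℕ) : {s : List ι | s.length ≤ n}.ncard ≤ (Nat.card ι + 1) ^ n := by
  let f : {s : List ι | s.length ≤ n} → (Fin n → Option ι) := fun s i => s.1[(i : ℕ)]?
  have hf : Function.Injective f := by
    rintro ⟨s, hs⟩ ⟨t, ht⟩ hst
    have : s = t := by
      apply List.ext_getElem?
      intro i
      by_cases hi : i < n
      · exact congrFun hst ⟨i, hi⟩
      · rw [Set.mem_ofPred_eq] at hs ht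
        rw [List.getElem?_eq_none (by omega), List.getElem?_eq_none (by omega)]
    subst this
    rfl
  have h := Nat.card_le_card_of_injective f hf
  rw [Nat.card_coe_set_eq, Nat.card_fun, Nat.card_eq_fintype_card (α := Fin n), Fintype.card_fin,
    Finite.card_option] at h
  exact h

theorem finite_wordsLE {wt : ι → ℕ} (hwt : ∀ i, 1 ≤ wt i) (n : ℕ) : (wordsLE wt n).Finite :=
  (finite_setOf_length_le n).subset (wordsLE_subset hwt n)

/-- The pairs of words of total weight at most `n` whose first word is longer than the second. -/
def wordPairsLE (wt : ι → ℕ) (n : ℕ) : Set (List ι × List ι) :=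
  {q | q.2.length < q.1.length ∧ wordWeight wt q.1 + wordWeight wt q.2 ≤ n}

theorem finite_wordPairsLE {wt : ι → ℕ} (hwt : ∀ i, 1 ≤ wt i) (n : ℕ) :
    (wordPairsLE wt n).Finite := by
  refine ((finite_wordsLE hwt n).prod (finite_wordsLE hwt n)).subset ?_
  rintro ⟨s, t⟩ ⟨-, h⟩
  simp only [wordsLE, Set.mem_prod, Set.mem_ofPred_eq] at h ⊢
  omega

/-- Splitting the words of length at least `2 h` after fewer than `h` letters yields many pairs. -/
theorem mul_ncard_wordsLE_le {wt : ι → ℕ} (hwt : ∀ i, 1 ≤ wt i) (n h : ℕ) :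
    h * (wordsLE wt n).ncard ≤ (wordPairsLE wt n).ncard + h * (Nat.card ι + 1) ^ (2 * h) := by
  set A := {s ∈ wordsLE wt n | 2 * h ≤ s.length}
  have hA : A.Finite := (finite_wordsLE hwt n).subset (Set.sep_subset _ _)
  have h1 : (wordsLE wt n).ncard ≤ A.ncard + (Nat.card ι + 1) ^ (2 * h) := by
    have hsub : wordsLE wt n ⊆ A ∪ {s | s.length ≤ 2 * h} := by
      intro s hs
      by_cases hlen : 2 * h ≤ s.length
      · exact Or.inl ⟨hs, hlen⟩
      · exact Or.inr (by simp only [Set.mem_ofPred_eq]; omega)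
    refine (Set.ncard_le_ncard hsub (hA.union (finite_setOf_length_le _))).trans ?_
    exact (Set.ncard_union_le _ _).trans (Nat.add_le_add_left (ncard_length_le _) _)
  have h2 : h * A.ncard ≤ (wordPairsLE wt n).ncard := by
    let f : List ι × ℕ → List ι × List ι := fun q => (q.1.drop q.2, q.1.take q.2)
    have hmaps : Set.MapsTo f (A ×ˢ Set.Iio h) (wordPairsLE wt n) := by
      rintro ⟨s, j⟩ ⟨⟨hs, hlen⟩, hj⟩
      have hj' : j < h := hj
      have hlen' : 2 * h ≤ s.length := hlen
      refine ⟨?_, ?_⟩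
      · simp only [f, List.length_take, List.length_drop]
        omega
      · rw [add_comm, ← wordWeight_append, List.take_append_drop]
        exact hs
    have hinj : Set.InjOn f (A ×ˢ Set.Iio h) := by
      rintro ⟨s, j⟩ ⟨⟨-, hlen⟩, hj⟩ ⟨s', j'⟩ ⟨⟨-, hlen'⟩, hj'⟩ heq
      simp only [Set.mem_Iio] at hj hj'
      simp only [f, Prod.mk.injEq] at heq
      have hs : s = s' := by
        rw [← List.take_append_drop j s, ← List.take_append_drop j' s', heq.1, heq.2]
      have hjj := congrArg List.length heq.2
      simp only [List.length_take] at hjj hlen hlen'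
      rw [Prod.mk.injEq]
      exact ⟨hs, by omega⟩
    have h3 := Set.ncard_le_ncard_of_injOn f hmaps hinj (finite_wordPairsLE hwt n)
    rw [Set.ncard_prod] at h3
    have h4 : (Set.Iio h).ncard = h := by
      rw [← Finset.coe_range, Set.ncard_coe_finset, card_range]
    rw [h4] at h3
    linarith
  nlinarith

end Words

variable [Finite X]

/-- The image of a finitely generated subalgebra in `L / L_{>n}` has at most as many dimensions
as there are words of weight at most `n` in the generators. -/
theorem finrank_map_lieSpan_le {ι : Type*} [Finite ι] {wt : ι → ℕ} (hwt : ∀ i, 1 ≤ wt i)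
    {g : ι → 𝓛} (hg : ∀ i, g i ∈ 𝓗 (wt i)) (n : ℕ) :
    Module.finrank K ((LieSubalgebra.lieSpan K 𝓛 (Set.range g)).toSubmodule.map
      (degreeGT 𝓗 n).mkQ) ≤ (wordsLE wt n).ncard := by
  set S : Set (List ι × ι) := {q | wordWeight wt (q.2 :: q.1) ≤ n}
  let e : List ι × ι → List ι := fun q => q.2 :: q.1
  have he : Function.Injective e := by
    rintro ⟨s, i⟩ ⟨t, j⟩ h
    simpa [e, and_comm] using h
  have hSfin : S.Finite := Set.Finite.preimage he.injOn (finite_wordsLE hwt n)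
  have hScard : S.ncard ≤ (wordsLE wt n).ncard :=
    Set.ncard_le_ncard_of_injOn e (fun q hq => hq) he.injOn (finite_wordsLE hwt n)
  let v : List ι × ι → 𝓛 ⧸ degreeGT 𝓗 n := fun q =>
    (degreeGT 𝓗 n).mkQ (iteratedLie g q.1 (g q.2))
  have hle : (LieSubalgebra.lieSpan K 𝓛 (Set.range g)).toSubmodule.map (degreeGT 𝓗 n).mkQ ≤
      Submodule.span K (v '' S) := by
    refine (Submodule.map_mono (lieSpan_le_span_iteratedLie g)).trans ?_
    rw [Submodule.map_span, Submodule.span_le]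
    rintro _ ⟨_, ⟨⟨s, i⟩, rfl⟩, rfl⟩
    by_cases hq : (s, i) ∈ S
    · exact Submodule.subset_span ⟨(s, i), hq, rfl⟩
    · have h1 := iteratedLie_mem_of_wordWeight hg s (hg i)
      have h2 : (degreeGT 𝓗 n).mkQ (iteratedLie g s (g i)) = 0 := by
        rw [Submodule.mkQ_apply, Submodule.Quotient.mk_eq_zero]
        refine mem_degreeGT ?_ h1
        simp only [S, Set.mem_ofPred_eq, wordWeight, List.map_cons, List.sum_cons] at hq ⊢
        omega
      rw [SetLike.mem_coe]
      simp only [h2]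
      exact zero_mem _
  have hfin : (v '' S).Finite := hSfin.image v
  refine (Submodule.finrank_mono hle).trans ?_
  have := hfin.fintype
  refine (finrank_span_le_card (v '' S)).trans ?_
  rw [Set.toFinset_card, ← Nat.card_eq_fintype_card, Nat.card_coe_set_eq]
  exact (Set.ncard_image_le hSfin).trans hScard

/-- Linearly independent homogeneous elements of weight at most `n` remain linearly independent
in `L / L_{>n}`. -/
theorem card_le_finrank_quotient {ι : Type*} [Finite ι] {v : ι → 𝓛}
    (hv : LinearIndependent K v) {n : ℕ} (hn : ∀ i, ∃ k, k ≤ n ∧ v i ∈ 𝓗 k) :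
    Nat.card ι ≤ Module.finrank K (𝓛 ⧸ degreeGT 𝓗 n) := by
  have hspan : ∀ x ∈ Submodule.span K (Set.range v),
      ∑ i ∈ range (n + 1), weightProj K X i x = x := by
    intro x hx
    induction hx using Submodule.span_induction with
    | mem x hx =>
      obtain ⟨i, rfl⟩ := hx
      obtain ⟨k, hk, hik⟩ := hn i
      simp only [weightProj_of_mem hik]
      rw [sum_ite_eq, if_pos (by simpa using Nat.lt_succ_of_le hk)]
    | zero => simp
    | add x y _ _ hx hy => simp only [map_add, sum_add_distrib, hx, hy]
    | smul c x _ hx => simp only [map_smul, ← smul_sum, hx]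
  have hli : LinearIndependent K ((degreeGT 𝓗 n).mkQ ∘ v) := by
    refine hv.map (Submodule.disjoint_def.2 fun x hx hx' => ?_)
    rw [Submodule.ker_mkQ] at hx'
    rw [← hspan x hx]
    refine sum_eq_zero fun i hi => weightProj_eq_zero_of_mem_degreeGT ?_ hx'
    have := mem_range.1 hi
    omega
  have := Fintype.ofFinite ι
  rw [Nat.card_eq_fintype_card]
  exact hli.fintype_card_le_finrank

/-- If an element `z` of weight `w` is free over the generators `g`, then `[s · z, t · z]` for
words `s` longer than `t` are linearly independent, which bounds the number of such pairs. -/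
theorem ncard_wordPairsLE_le {ι : Type*} [Finite ι] {wt : ι → ℕ} (hwt : ∀ i, 1 ≤ wt i)
    {g : ι → 𝓛} (hg : ∀ i, g i ∈ 𝓗 (wt i)) {z : 𝓛} {w : ℕ} (hz : z ∈ 𝓗 w)
    (hfree : IsFreeFamily K (Sum.elim g fun _ : Unit => z)) (n : ℕ) :
    (wordPairsLE wt n).ncard ≤ Module.finrank K (𝓛 ⧸ degreeGT 𝓗 (n + 2 * w)) := by
  have h1 : IsFreeFamily K fun s : List ι => iteratedLie g s z := by
    have h := hfree.iteratedLie.comp_injective (e := fun s : List ι => (s, ()))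
      (fun s t hst => (Prod.ext_iff.1 hst).1)
    exact h
  have h2 := h1.linearIndependent_lie (wordPairsLE wt n) (by
    rintro s t ⟨h, -⟩ ⟨h', -⟩
    simp only at h h'
    omega)
  have := (finite_wordPairsLE hwt n).to_subtype
  rw [← Nat.card_coe_set_eq]
  refine card_le_finrank_quotient h2 ?_
  rintro ⟨⟨s, t⟩, -, hst⟩
  refine ⟨_, ?_, lie_mem_homogeneousComponent (iteratedLie_mem_of_wordWeight hg s hz)
    (iteratedLie_mem_of_wordWeight hg t hz)⟩
  simp only at hst
  omega

/-- A finitely generated Lie subalgebra, with an irredundant set of homogeneous generators of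
weight at least `2`, cannot have positive density. -/
theorem not_forall_mul_finrank_le {x₀ x₁ : X} (hx : x₀ ≠ x₁) {Y : Set 𝓛} (hfin : Y.Finite)
    (hirr : IsIrredundant K Y) (hY : ∀ y ∈ Y, ∃ k, 2 ≤ k ∧ y ∈ 𝓗 k) {α C : ℝ} (hα : 0 < α) :
    ¬ ∀ n, α * Module.finrank K (𝓛 ⧸ degreeGT 𝓗 n) ≤
      Module.finrank K ((LieSubalgebra.lieSpan K 𝓛 Y).toSubmodule.map (degreeGT 𝓗 n).mkQ) + C := by
  classical
  intro hdens
  have := hfin.to_subtype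
  have hY' : ∀ y : Y, ∃ k, 2 ≤ k ∧ (y : 𝓛) ∈ 𝓗 k := fun y => hY y y.2
  choose wt hwt2 hwt using hY'
  have hwt1 : ∀ y, 1 ≤ wt y := fun y => by have := hwt2 y; omega
  -- an element `z` outside the subalgebra, of weight at least those of `Y`, is free over `Y`
  obtain ⟨N, hN⟩ : ∃ N, ∀ y, wt y ≤ N := by
    obtain ⟨N, hN⟩ := (Set.finite_range wt).bddAbove
    exact ⟨N, fun y => hN ⟨y, rfl⟩⟩
  obtain ⟨s, hs, hsY⟩ := exists_iteratedLie_notMem hx hfin hY N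
  set z := iteratedLie (fun _ => FreeLieAlgebra.of K x₀) s (FreeLieAlgebra.of K x₁)
  have hz : z ∈ 𝓗 (s.length * 1 + 1) :=
    iteratedLie_mem (of_mem_homogeneousComponent x₀) (of_mem_homogeneousComponent x₁) s
  set w := s.length * 1 + 1
  have hzY : z ∉ Y := fun h => hsY (LieSubalgebra.subset_lieSpan h)
  have hfree : IsFreeFamily K (Sum.elim ((↑) : Y → 𝓛) fun _ : Unit => z) := by
    have h1 : IsIrredundant K (insert z Y) := hirr.insert_of_weight_le
      (fun b hb => ⟨wt ⟨b, hb⟩, by have := hN ⟨b, hb⟩; omega, hwt ⟨b, hb⟩⟩) hz hsY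
    have h2 := h1.isFreeFamily (by
      rintro y (rfl | hy)
      · exact ⟨w, hz⟩
      · exact ⟨_, hwt ⟨y, hy⟩⟩)
    let e : Y ⊕ Unit → (insert z Y : Set 𝓛) :=
      Sum.elim (fun y => ⟨y, Set.mem_insert_of_mem _ y.2⟩) fun _ => ⟨z, Set.mem_insert _ _⟩
    have he : Function.Injective e := by
      rintro (⟨a, ha⟩ | _) (⟨b, hb⟩ | _) h
      · have : a = b := congrArg Subtype.val h
        subst this
        rfl
      · exact absurd (show a = z from congrArg Subtype.val h) (fun h => hzY (h ▸ ha))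
      · exact absurd (show z = b from congrArg Subtype.val h) (fun h => hzY (h ▸ hb))
      · rfl
    have h3 := h2.comp_injective he
    convert h3 using 1
    ext (y | y) <;> rfl
  set U : ℕ → ℝ := fun n => ((wordsLE wt n).ncard : ℝ)
  set q : ℝ := (Nat.card Y : ℝ) + 1
  have hq : 1 ≤ q := by simp [q]
  have hupper : ∀ n, α * Module.finrank K (𝓛 ⧸ degreeGT 𝓗 n) ≤ U n + C := by
    intro n
    have h1 := finrank_map_lieSpan_le (K := K) hwt1 (g := ((↑) : Y → 𝓛)) hwt n
    rw [Subtype.range_coe] at h1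
    have h2 : (Module.finrank K ((LieSubalgebra.lieSpan K 𝓛 Y).toSubmodule.map
      (degreeGT 𝓗 n).mkQ) : ℝ) ≤ U n := by
      simp only [U]
      exact_mod_cast h1
    linarith [hdens n]
  have hpow : ∀ n, U n ≤ q ^ n := by
    intro n
    have h := (Set.ncard_le_ncard (wordsLE_subset hwt1 n) (finite_setOf_length_le n)).trans
      (ncard_length_le n)
    simp only [U, q]
    exact_mod_cast h
  have hgrow : ∀ h n : ℕ, α * (h * U n) ≤ U (n + 2 * w) + (C + α * (h * q ^ (2 * h))) := by
    intro h n
    have h1 := (mul_ncard_wordsLE_le hwt1 n h).trans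
      (Nat.add_le_add_right (ncard_wordPairsLE_le hwt1 hwt hz hfree n) _)
    have h2 : (h : ℝ) * U n ≤ Module.finrank K (𝓛 ⧸ degreeGT 𝓗 (n + 2 * w)) + h * q ^ (2 * h) := by
      simp only [U, q]
      exact_mod_cast h1
    have h3 := hupper (n + 2 * w)
    have h4 := mul_le_mul_of_nonneg_left h2 hα.le
    rw [mul_add] at h4
    linarith
  -- `U` grows faster along `n ↦ n + 2 w` than the bound `q ^ n` permits
  set c : ℝ := q ^ (2 * w)
  have hc : 1 ≤ c := one_le_pow₀ hq
  obtain ⟨h, hh⟩ := exists_nat_ge ((2 * c + 1) / α)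
  have hh' : 2 * c + 1 ≤ α * h := by
    rw [div_le_iff₀ hα] at hh
    linarith
  set E : ℝ := max (C + α * (h * q ^ (2 * h))) 1
  have hUnonneg : ∀ n, 0 ≤ U n := fun n => Nat.cast_nonneg _
  have hstep : ∀ n, E ≤ U n → 2 * c * U n ≤ U (n + 2 * w) := by
    intro n hn
    have h1 := hgrow h n
    have h2 : (2 * c + 1) * U n ≤ α * (h * U n) := by
      rw [← mul_assoc]
      exact mul_le_mul_of_nonneg_right hh' (hUnonneg n)
    have h3 : C + α * (h * q ^ (2 * h)) ≤ E := le_max_left _ _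
    linarith
  obtain ⟨n₀, hn₀⟩ : ∃ n, E ≤ U n := by
    obtain ⟨n, hn⟩ := exists_nat_ge ((E + C) / α)
    refine ⟨n, ?_⟩
    rw [div_le_iff₀ hα] at hn
    have h1 : n ≤ Module.finrank K (𝓛 ⧸ degreeGT 𝓗 n) := by
      rw [finrank_quotient_degreeGT]
      exact le_sum_finrank_homogeneousComponent hx n
    have h2 : (n : ℝ) ≤ Module.finrank K (𝓛 ⧸ degreeGT 𝓗 n) := by exact_mod_cast h1
    have h3 := mul_le_mul_of_nonneg_left h2 hα.le
    linarith [hupper n]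
  have hE1 : 1 ≤ E := le_max_right _ _
  have hiter : ∀ k : ℕ, (2 * c) ^ k * E ≤ U (n₀ + k * (2 * w)) := by
    intro k
    induction k with
    | zero => simpa using hn₀
    | succ k ih =>
      have hpos : 1 ≤ (2 * c) ^ k := one_le_pow₀ (by linarith)
      have h1 := hstep _ (le_trans (by nlinarith) ih)
      have h2 : n₀ + (k + 1) * (2 * w) = n₀ + k * (2 * w) + 2 * w := by ring
      rw [h2]
      refine le_trans ?_ h1
      rw [pow_succ']
      nlinarith
  obtain ⟨k, hk⟩ := pow_unbounded_of_one_lt (q ^ n₀) (one_lt_two (α := ℝ))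
  have h1 := (hiter k).trans (hpow _)
  have hck : 0 < c ^ k := pow_pos (by linarith) k
  rw [pow_add, mul_comm k, pow_mul, mul_pow] at h1
  have h2 : (2 : ℝ) ^ k * c ^ k ≤ 2 ^ k * c ^ k * E :=
    le_mul_of_one_le_right (by positivity) hE1
  have h3 : (2 : ℝ) ^ k * c ^ k ≤ q ^ n₀ * c ^ k := h2.trans h1
  exact absurd (le_of_mul_le_mul_right h3 hck) (not_le.2 hk)

end Growth

/-! ### Densities of free subalgebras -/

section Density

variable {K : Type*} [Field K] {X : Type*}

local notation "𝓛" => FreeLieAlgebra K X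
local notation "𝓗" => homogeneousComponent K X

theorem isLieAbelian_of_subsingleton [Subsingleton X] : IsLieAbelian 𝓛 := by
  have h1 : ∀ (i : X) (v : 𝓛), ⁅FreeLieAlgebra.of K i, v⁆ = 0 := by
    intro i v
    induction v using freeLieAlgebra_induction with
    | hof j => rw [Subsingleton.elim j i, lie_self]
    | hadd a b ha hb => rw [lie_add, ha, hb, add_zero]
    | hsmul c a ha => rw [lie_smul, ha, smul_zero]
    | h0 => exact lie_zero _
    | hlie a b ha hb => rw [leibniz_lie, ha, hb, zero_lie, lie_zero, add_zero]
  refine ⟨fun u v => ?_⟩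
  induction u using freeLieAlgebra_induction generalizing v with
  | hof i => exact h1 i v
  | hadd a b ha hb => rw [add_lie, ha, hb, add_zero]
  | hsmul c a ha => rw [smul_lie, ha, smul_zero]
  | h0 => exact zero_lie _
  | hlie a b ha hb => rw [lie_lie, ha, hb, sub_zero]

variable [Finite X]

theorem finrank_map_div_le_one (M : LieSubalgebra K 𝓛) (n : ℕ) :
    (Module.finrank K (M.toSubmodule.map (degreeGT 𝓗 n).mkQ) : ℝ) /
      (Module.finrank K (𝓛 ⧸ degreeGT 𝓗 n) : ℝ) ≤ 1 := by
  refine div_le_one_of_le₀ ?_ (Nat.cast_nonneg _)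
  exact_mod_cast Submodule.finrank_le _

theorem density_mem_Icc (M : LieSubalgebra K 𝓛) : density 𝓗 M ∈ Set.Icc (0 : ℝ) 1 := by
  have h0 : ∀ n, 0 ≤ (Module.finrank K (M.toSubmodule.map (degreeGT 𝓗 n).mkQ) : ℝ) /
      (Module.finrank K (𝓛 ⧸ degreeGT 𝓗 n) : ℝ) := fun n => by positivity
  have hb1 : Filter.IsBoundedUnder (· ≥ ·) Filter.atTop fun n =>
      (Module.finrank K (M.toSubmodule.map (degreeGT 𝓗 n).mkQ) : ℝ) /
      (Module.finrank K (𝓛 ⧸ degreeGT 𝓗 n) : ℝ) :=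
    Filter.isBoundedUnder_of ⟨0, fun n => h0 n⟩
  have hb2 : Filter.IsBoundedUnder (· ≤ ·) Filter.atTop fun n =>
      (Module.finrank K (M.toSubmodule.map (degreeGT 𝓗 n).mkQ) : ℝ) /
      (Module.finrank K (𝓛 ⧸ degreeGT 𝓗 n) : ℝ) :=
    Filter.isBoundedUnder_of ⟨1, fun n => finrank_map_div_le_one M n⟩
  constructor
  · exact Filter.le_liminf_of_le hb2.isCoboundedUnder_ge (Filter.Eventually.of_forall h0)
  · exact Filter.liminf_le_of_frequently_le
      (Filter.Eventually.of_forall (finrank_map_div_le_one M)).frequently hb1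

/-- The density is `α` if the dimensions stay above `α` times those of `L`, up to a constant,
and are infinitely often at most `α` times those of `L`. -/
theorem density_eq_of_bounds {x₀ x₁ : X} (hx : x₀ ≠ x₁) (M : LieSubalgebra K 𝓛) {α C : ℝ}
    (hlower : ∀ n, α * Module.finrank K (𝓛 ⧸ degreeGT 𝓗 n) ≤
      Module.finrank K (M.toSubmodule.map (degreeGT 𝓗 n).mkQ) + C)
    (hfreq : ∀ N, ∃ n, N ≤ n ∧ (Module.finrank K (M.toSubmodule.map (degreeGT 𝓗 n).mkQ) : ℝ) ≤
      α * Module.finrank K (𝓛 ⧸ degreeGT 𝓗 n)) : density 𝓗 M = α := by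
  classical
  set a : ℕ → ℝ := fun n => Module.finrank K (M.toSubmodule.map (degreeGT 𝓗 n).mkQ)
  set S : ℕ → ℝ := fun n => Module.finrank K (𝓛 ⧸ degreeGT 𝓗 n)
  have hS : ∀ n : ℕ, (n : ℝ) ≤ S n := by
    intro n
    simp only [S]
    rw [finrank_quotient_degreeGT]
    exact_mod_cast le_sum_finrank_homogeneousComponent hx n
  have hSpos : ∀ n : ℕ, 1 ≤ n → 0 < S n := by
    intro n hn
    have h1 : (1 : ℝ) ≤ n := by exact_mod_cast hn
    linarith [hS n]
  have hStop : Filter.Tendsto S Filter.atTop Filter.atTop :=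
    Filter.tendsto_atTop_mono hS tendsto_natCast_atTop_atTop
  have hbelow : Filter.IsBoundedUnder (· ≥ ·) Filter.atTop fun n => a n / S n :=
    Filter.isBoundedUnder_of ⟨0, fun n => by positivity⟩
  have habove : Filter.IsBoundedUnder (· ≤ ·) Filter.atTop fun n => a n / S n :=
    Filter.isBoundedUnder_of ⟨1, fun n => finrank_map_div_le_one M n⟩
  change Filter.liminf (fun n => a n / S n) Filter.atTop = α
  apply le_antisymm
  · refine Filter.liminf_le_of_frequently_le (Filter.frequently_atTop.2 fun N => ?_) hbelow
    obtain ⟨n, hn, hle⟩ := hfreq (max N 1)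
    refine ⟨n, (le_max_left _ _).trans hn, ?_⟩
    rw [div_le_iff₀ (hSpos n ((le_max_right _ _).trans hn))]
    exact hle
  · have hlim : Filter.Tendsto (fun n => α - C / S n) Filter.atTop (nhds α) := by
      have h := (hStop.const_div_atTop C).const_sub α
      simpa using h
    rw [← hlim.liminf_eq]
    refine Filter.liminf_le_liminf ?_ hlim.isBoundedUnder_ge habove.isCoboundedUnder_ge
    filter_upwards [Filter.eventually_ge_atTop 1] with n hn
    have hpos := hSpos n hn
    rw [le_div_iff₀ hpos, sub_mul, div_mul_cancel₀ _ hpos.ne']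
    linarith [hlower n]

/-- Every `α ∈ [0, 1]` is the density of a Lie subalgebra freely generated by basic commutators. -/
theorem exists_isFreelyGeneratedBy_density {r : FreeMagma X → FreeMagma X → Prop}
    (hr : IsBasicOrder r) {x₀ x₁ : X} (hx : x₀ ≠ x₁) {α : ℝ} (hα : α ∈ Set.Icc (0 : ℝ) 1) :
    ∃ (M : LieSubalgebra K 𝓛) (Y : Set 𝓛), Y ⊆ basicCommutators K r ∧ IsFreelyGeneratedBy M Y ∧
      density 𝓗 M = α := by
  obtain ⟨hα0, hα1⟩ := hα
  set S : ℕ → ℕ := fun n => Module.finrank K (𝓛 ⧸ degreeGT 𝓗 n)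
  have hSsucc : ∀ n, S (n + 1) = S n + Module.finrank K (𝓗 (n + 1)) := by
    intro n
    simp only [S]
    rw [finrank_quotient_degreeGT, finrank_quotient_degreeGT, sum_range_succ]
  -- subtracting `S 1` forces all generators to have weight at least `2`
  let τ : ℕ → ℕ := fun n => ⌊α * ((S n - S 1 : ℕ) : ℝ)⌋₊
  have hτle : ∀ n, (τ n : ℝ) ≤ α * S n := by
    intro n
    refine (Nat.floor_le (by positivity)).trans ?_
    have : ((S n - S 1 : ℕ) : ℝ) ≤ S n := by exact_mod_cast Nat.sub_le _ _
    exact mul_le_mul_of_nonneg_left this hα0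
  have hτge : ∀ n, α * S n ≤ τ n + (α * S 1 + 1) := by
    intro n
    have h1 := (Nat.lt_floor_add_one (α * ((S n - S 1 : ℕ) : ℝ))).le
    have h2 : (S n : ℝ) ≤ ((S n - S 1 : ℕ) : ℝ) + S 1 := by
      exact_mod_cast (by omega : S n ≤ S n - S 1 + S 1)
    have h3 := mul_le_mul_of_nonneg_left h2 hα0
    rw [mul_add] at h3
    change α * S n ≤ (⌊α * ((S n - S 1 : ℕ) : ℝ)⌋₊ : ℝ) + _
    linarith
  have hτ0 : τ 0 = 0 := by
    have : S 1 = S 0 + Module.finrank K (𝓗 1) := hSsucc 0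
    have : S 0 - S 1 = 0 := by omega
    simp [τ, this]
  have hτ1 : τ 1 = 0 := by simp [τ]
  have hτ : ∀ n, τ (n + 1) ≤ τ n + Module.finrank K (𝓗 (n + 1)) := by
    intro n
    rw [← Nat.floor_add_natCast (by positivity)]
    refine Nat.floor_le_floor ?_
    have h1 : ((S (n + 1) - S 1 : ℕ) : ℝ) ≤
        ((S n - S 1 : ℕ) : ℝ) + Module.finrank K (𝓗 (n + 1)) := by
      have := hSsucc n
      exact_mod_cast (by omega : S (n + 1) - S 1 ≤ S n - S 1 + Module.finrank K (𝓗 (n + 1)))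
    have h2 := mul_le_mul_of_nonneg_left h1 hα0
    have h3 : α * (Module.finrank K (𝓗 (n + 1)) : ℝ) ≤ Module.finrank K (𝓗 (n + 1)) :=
      mul_le_of_le_one_left (Nat.cast_nonneg _) hα1
    rw [mul_add] at h2
    linarith
  obtain ⟨Z, hmono, hZ0, hpart, hweight, hge, hcase⟩ := exists_greedy_sequence K hr τ hτ0 hτ
  set Y := ⋃ m, Z m
  have hhom : ∀ n, ∀ b ∈ Z n, ∃ k, b ∈ 𝓗 k := fun n b hb =>
    ((hpart n).weight b hb).imp fun _ h => h.2
  have hYhom : ∀ b ∈ Y, ∃ k, b ∈ 𝓗 k := by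
    intro b hb
    obtain ⟨n, hn⟩ := Set.mem_iUnion.1 hb
    exact hhom n b hn
  have hrank : ∀ n, Module.finrank K ((LieSubalgebra.lieSpan K 𝓛 Y).toSubmodule.map
      (degreeGT 𝓗 n).mkQ) = ∑ i ∈ range (n + 1), componentRank Y i := fun n =>
    finrank_map_mkQ _ (fun x hx n => weightProj_mem_lieSpan hYhom hx n) n
  have hlower : ∀ n, α * S n ≤ Module.finrank K ((LieSubalgebra.lieSpan K 𝓛 Y).toSubmodule.map
      (degreeGT 𝓗 n).mkQ) + (α * S 1 + 1) := by
    intro n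
    have h1 : (τ n : ℝ) ≤ Module.finrank K ((LieSubalgebra.lieSpan K 𝓛 Y).toSubmodule.map
      (degreeGT 𝓗 n).mkQ) := by
      rw [hrank]
      exact_mod_cast hge n
    linarith [hτge n]
  refine ⟨LieSubalgebra.lieSpan K 𝓛 Y, Y, ?_, ⟨rfl, ?_⟩, density_eq_of_bounds hx _ hlower ?_⟩
  · refine Set.iUnion_subset fun n => (hpart n).basic.trans (Set.image_mono fun w hw => hw.1)
  · exact isFreeFamily_iUnion hmono fun n => (hpart n).irredundant.isFreeFamily (hhom n)
  · -- otherwise no element is chosen in weights from `N` on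
    by_contra hno
    push Not at hno
    obtain ⟨N, hN⟩ := hno
    have hstable : ∀ n, N ≤ n → Z (n + 1) = Z n := by
      intro n hn
      refine (hcase n).resolve_right fun h => ?_
      have h1 := hN n hn
      rw [hrank] at h1
      have h2 : ((∑ i ∈ range (n + 1), componentRank Y i : ℕ) : ℝ) ≤ τ n := by
        exact_mod_cast h.2
      exact absurd (h2.trans (hτle n)) (not_le.2 h1)
    rcases hα0.eq_or_lt with rfl | hαpos
    · have hτz : ∀ n, τ n = 0 := fun n => by simp [τ]
      have hZe : ∀ n, Z n = ∅ := by
        intro n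
        induction n with
        | zero => exact hZ0
        | succ n ih =>
          rw [(hcase n).resolve_right fun h => by have := h.1; rw [hτz] at this; omega, ih]
      have hYe : Y = ∅ := Set.iUnion_eq_empty.2 hZe
      have h1 := hN N le_rfl
      rw [hYe, LieSubalgebra.span_empty, LieSubalgebra.bot_toSubmodule, Submodule.map_bot,
        finrank_bot] at h1
      simp at h1
    · have hYZ : Y = Z N := by
        have hn : ∀ m, Z (N + m) = Z N := by
          intro m
          induction m with
          | zero => rfl
          | succ m ih => rw [← ih]; exact hstable (N + m) (by omega)
        refine Set.Subset.antisymm (Set.iUnion_subset fun m => ?_) (Set.subset_iUnion Z N)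
        exact (hmono (by omega : m ≤ N + m)).trans (hn m).subset
      have h1 : Z 1 = ∅ := by
        rw [(hcase 0).resolve_right fun h => by have := h.1; omega, hZ0]
      have h2 : Z 2 = ∅ := by
        rw [(hcase 1).resolve_right fun h => by have := h.1; omega, h1]
      have hwt2 : ∀ n, ∀ b ∈ Z n, ∃ k, 2 ≤ k ∧ b ∈ 𝓗 k := by
        intro n
        induction n with
        | zero => simp [hZ0]
        | succ n ih =>
          intro b hb
          rcases hweight n b hb with h | h
          · exact ih b h
          · refine ⟨n, ?_, h⟩
            by_contra hn
            have h3 := hmono (by omega : n + 1 ≤ 2) hb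
            rw [h2] at h3
            exact h3
      have hfin : (Z N).Finite := by
        refine ((finite_setOf_length_lt N).image (commutatorValue K)).subset
          ((hpart N).basic.trans ?_)
        exact Set.image_mono fun w hw => hw.2
      rw [hYZ] at hlower
      exact not_forall_mul_finrank_le hx hfin (hpart N).irredundant (hwt2 N) hαpos hlower

end Density

end FreeLieDensity

end

theorem theorem3 (p : ℕ) [Fact p.Prime] (X : Type*) [Finite X]
    (hL : ¬ IsLieAbelian (FreeLieAlgebra (ZMod p) X)) :
    (∀ r : FreeMagma X → FreeMagma X → Prop, FreeLieDensity.IsBasicOrder r →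
      ∀ α ∈ Set.Icc (0 : ℝ) 1,
        ∃ (M : LieSubalgebra (ZMod p) (FreeLieAlgebra (ZMod p) X))
          (Y : Set (FreeLieAlgebra (ZMod p) X)),
          Y ⊆ FreeLieDensity.basicCommutators (ZMod p) r ∧
          FreeLieDensity.IsFreelyGeneratedBy M Y ∧
          FreeLieDensity.density (FreeLieDensity.homogeneousComponent (ZMod p) X) M = α) ∧
    FreeLieDensity.densitySpectrum (FreeLieDensity.homogeneousComponent (ZMod p) X)
      = Set.Icc (0 : ℝ) 1 := by
  have hX : ¬ Subsingleton X := fun _ => hL FreeLieDensity.isLieAbelian_of_subsingleton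
  rw [not_subsingleton_iff_nontrivial] at hX
  obtain ⟨x₀, x₁, hx⟩ := exists_pair_ne X
  refine ⟨fun r hr α hα => FreeLieDensity.exists_isFreelyGeneratedBy_density hr hx hα, ?_⟩
  apply Set.Subset.antisymm
  · rintro _ ⟨M, rfl⟩
    exact FreeLieDensity.density_mem_Icc M
  · intro α hα
    obtain ⟨r, hr⟩ := FreeLieDensity.exists_isBasicOrder X
    obtain ⟨M, -, -, -, hM⟩ :=
      FreeLieDensity.exists_isFreelyGeneratedBy_density (K := ZMod p) hr hx hα
    exact ⟨M, hM⟩
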